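/- Let $m\ge n\ge 2$, and let $Q_{m,n}$ be the $m\times n$ queen's graph: its vertices are the squares of a board with $m$ columns and $n$ rows, and two distinct squares are adjacent precisely if they lie in a common row, a common column, or a common diagonal of slope $\pm1$. A divisor on a finite graph $G$ is an element $D\in\mathbb{Z}^{V(G)}$; its degree is $\deg(D)=\sum_v D(v)$, and it is effective if $D(v)\ge 0$ for all $v$. Firing a vertex $v$ lowers $D(v)$ by the degree of $v$ and raises $D(w)$ by $1$ for each neighbor $w$ of $v$. Two divisors are equivalent if they differ by a sequence of such firings (or their inverses), and $[D]$ denotes the equivalence class of $D$; degree and rank depend only on the class. The rank $r(D)$ is $-1$ if $D$ is not equivalent to an effective divisor, and otherwise it is the largest $k\ge 0$ such that $D-E$ is equivalent to an effective divisor for every effective divisor $E$ of degree $k$. The gonality $\mathrm{gon}(G)$ is the minimum degree of a divisor of positive rank on $G$, and $\alpha(G)$ is the maximum size of an independent set of vertices of $G$. For $U\subseteq V(G)$ let $\mathbb{1}_U$ be the divisor with one chip on each vertex of $U$ and none elsewhere. Then $\mathrm{gon}(Q_{m,n})=mn-\alpha(Q_{m,n})$. More explicitly, \[\mathrm{gon}(Q_{m,n})=\begin{cases}3&\text{if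 } m=n=2,\\ 7&\text{if } m=n=3,\\ n(m-1)&\text{otherwise.}\end{cases}\] Moreover, the map $S\mapsto[\mathbb{1}_{S^c}]$ is a bijection from the set of maximum independent sets $S$ of $Q_{m,n}$ (independent sets of size $\alpha(Q_{m,n})$) to the set of divisor classes on $Q_{m,n}$ of rank $1$ and degree $\mathrm{gon}(Q_{m,n})$. -/

import Mathlib

/-! Chip-firing on finite graphs (divisors, rank, gonality) and the queen's graph. -/

namespace ChipFiring

/-- A divisor on a graph with vertex set `V`: an integer number of chips on every vertex. -/
abbrev Divisor (V : Type*) : Type _ := V → ℤ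

section General

variable {V : Type*} [Fintype V]

/-- The degree of a divisor: its total number of chips. -/
def degree (D : Divisor V) : ℤ := ∑ v, D v

/-- A divisor is effective if no vertex is in debt. -/
def Effective {V : Type*} (D : Divisor V) : Prop := ∀ v, 0 ≤ D v

/-- The divisor `𝟙_U` with one chip on every vertex of `U` and no chips elsewhere. -/
noncomputable def oneOn {V : Type*} (U : Set V) : Divisor V := U.indicator 1

variable [DecidableEq V] (G : SimpleGraph V) [DecidableRel G.Adj]

/-- Firing the vertex `v`: it sends one chip along each of its edges. -/
def fire (v : V) (D : Divisor V) : Divisor V := fun w =>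
  if w = v then D w - G.degree v else if G.Adj v w then D w + 1 else D w

/-- `D'` results from `D` by firing a single vertex. -/
def FireStep (D D' : Divisor V) : Prop := ∃ v, D' = fire G v D

/-- Chip-firing equivalence: the equivalence relation generated by firing single vertices. -/
def divisorSetoid : Setoid (Divisor V) := Relation.EqvGen.setoid (FireStep G)

/-- `D` and `D'` differ by a sequence of chip-firing moves. -/
def Equivalent (D D' : Divisor V) : Prop := (divisorSetoid G).r D D'

/-- `D` is equivalent to some effective divisor. -/
def Winnable (D : Divisor V) : Prop := ∃ D', Equivalent G D D' ∧ Effective D'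

/-- `r(D) ≥ k`: whenever `k` chips are removed, the result is equivalent to an effective divisor. -/
def RankGE (D : Divisor V) (k : ℕ) : Prop :=
  ∀ E : Divisor V, Effective E → degree E = k → Winnable G (D - E)

open Classical in
/-- The rank of a divisor: `-1` if it is not equivalent to an effective divisor, and otherwise
the largest `k` with `r(D) ≥ k`. -/
noncomputable def rank (D : Divisor V) : ℤ :=
  if Winnable G D then ((sSup {k : ℕ | RankGE G D k} : ℕ) : ℤ) else -1

/-- The gonality of a graph: the minimum degree of a divisor of positive rank. -/
noncomputable def gonality : ℤ := sInf {d : ℤ | ∃ D : Divisor V, 0 < rank G D ∧ degree D = d}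

/-- Divisor classes: divisors up to chip-firing equivalence. -/
def DivisorClass : Type _ := Quotient (divisorSetoid G)

/-- The class `[D]` of a divisor. -/
def divisorClass (D : Divisor V) : DivisorClass G := Quotient.mk (divisorSetoid G) D

theorem degree_fire (v : V) (D : Divisor V) : degree (fire G v D) = degree D := by
  have h : ∀ w, fire G v D w
      = D w + ((if G.Adj v w then 1 else 0) - (if w = v then (G.degree v : ℤ) else 0)) := by
    intro w
    unfold fire
    by_cases hw : w = v
    · subst hw; simp [sub_eq_add_neg]
    · by_cases ha : G.Adj v w <;> simp [hw, ha]
  have hd : (∑ w, if G.Adj v w then (1 : ℤ) else 0) = G.degree v := by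
    rw [Finset.sum_boole, ← G.card_neighborFinset_eq_degree, G.neighborFinset_eq_filter]
  unfold degree
  rw [Finset.sum_congr rfl fun w _ => h w, Finset.sum_add_distrib, Finset.sum_sub_distrib, hd]
  simp

theorem degree_eq_of_equivalent {D D' : Divisor V} (h : Equivalent G D D') :
    degree D = degree D' := by
  change Relation.EqvGen (FireStep G) D D' at h
  induction h with
  | rel _ _ h => obtain ⟨v, rfl⟩ := h; exact (degree_fire G v _).symm
  | refl _ => rfl
  | symm _ _ _ ih => exact ih.symm
  | trans _ _ _ _ _ ih1 ih2 => exact ih1.trans ih2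

theorem equivalent_sub {D D' : Divisor V} (h : Equivalent G D D') (E : Divisor V) :
    Equivalent G (D - E) (D' - E) := by
  change Relation.EqvGen (FireStep G) D D' at h
  change Relation.EqvGen (FireStep G) (D - E) (D' - E)
  induction h with
  | rel x y h =>
    obtain ⟨v, rfl⟩ := h
    refine Relation.EqvGen.rel _ _ ⟨v, ?_⟩
    funext w
    simp only [fire, Pi.sub_apply]
    split_ifs <;> ring
  | refl _ => exact Relation.EqvGen.refl _
  | symm _ _ _ ih => exact Relation.EqvGen.symm _ _ ih
  | trans _ _ _ _ _ ih1 ih2 => exact Relation.EqvGen.trans _ _ _ ih1 ih2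

theorem winnable_congr {D D' : Divisor V} (h : Equivalent G D D') :
    Winnable G D ↔ Winnable G D' :=
  ⟨fun ⟨F, h1, h2⟩ => ⟨F, (divisorSetoid G).trans ((divisorSetoid G).symm h) h1, h2⟩,
    fun ⟨F, h1, h2⟩ => ⟨F, (divisorSetoid G).trans h h1, h2⟩⟩

theorem rank_eq_of_equivalent {D D' : Divisor V} (h : Equivalent G D D') :
    rank G D = rank G D' := by
  have h1 : ∀ k, RankGE G D k ↔ RankGE G D' k := fun k =>
    forall_congr' fun E => imp_congr_right fun _ => imp_congr_right fun _ =>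
      winnable_congr G (equivalent_sub G h E)
  have h2 := winnable_congr G h
  unfold rank
  simp only [h1]
  by_cases hw : Winnable G D'
  · rw [if_pos hw, if_pos (h2.2 hw)]
  · rw [if_neg hw, if_neg (mt h2.1 hw)]

/-- The degree of a divisor class. -/
def classDegree : DivisorClass G → ℤ :=
  Quotient.lift (s := divisorSetoid G) degree fun _ _ h => degree_eq_of_equivalent G h

/-- The rank of a divisor class. -/
noncomputable def classRank : DivisorClass G → ℤ :=
  Quotient.lift (s := divisorSetoid G) (rank G) fun _ _ h => rank_eq_of_equivalent G h

end General

/-- The `m × n` queen's graph. The square `(i, j)` lies in column `i` (of `m`) and row `j` (of `n`);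
distinct squares are adjacent if they share a row, a column, or a diagonal of slope `±1`. -/
def queenGraph (m n : ℕ) : SimpleGraph (Fin m × Fin n) where
  Adj p q := p ≠ q ∧ (p.1 = q.1 ∨ p.2 = q.2 ∨
    ((p.2 : ℕ) : ℤ) - ((q.2 : ℕ) : ℤ) = ((p.1 : ℕ) : ℤ) - ((q.1 : ℕ) : ℤ) ∨
    ((p.2 : ℕ) : ℤ) - ((q.2 : ℕ) : ℤ) = -(((p.1 : ℕ) : ℤ) - ((q.1 : ℕ) : ℤ)))
  symm := ⟨by
    rintro p q ⟨h, h'⟩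
    refine ⟨h.symm, ?_⟩
    rcases h' with h' | h' | h' | h'
    · exact Or.inl h'.symm
    · exact Or.inr (Or.inl h'.symm)
    · exact Or.inr (Or.inr (Or.inl (by omega)))
    · exact Or.inr (Or.inr (Or.inr (by omega)))⟩
  loopless := ⟨fun _ h => h.1 rfl⟩

instance (m n : ℕ) : DecidableRel (queenGraph m n).Adj := fun p q =>
  inferInstanceAs (Decidable (p ≠ q ∧ (p.1 = q.1 ∨ p.2 = q.2 ∨
    ((p.2 : ℕ) : ℤ) - ((q.2 : ℕ) : ℤ) = ((p.1 : ℕ) : ℤ) - ((q.1 : ℕ) : ℤ) ∨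
    ((p.2 : ℕ) : ℤ) - ((q.2 : ℕ) : ℤ) = -(((p.1 : ℕ) : ℤ) - ((q.1 : ℕ) : ℤ)))))

end ChipFiring

set_option linter.unusedSectionVars false

/-! Upper bound: for an independent set S, the divisor with one chip off S has positive rank,
because a chipless vertex can borrow once from its neighbours, none of which is in S
(`rankGE_one_oneOn_compl`). By `gonality_eq_and_bijOn`, everything else follows from two facts:
distinct sets S give inequivalent divisors (`eq_of_equivalent_oneOn_compl`), and every effective
divisor of positive rank and degree at most |V| - α is equivalent to one coming from a maximum
independent set.

For the second fact, the set where a firing script is maximal can be fired legally whenever the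
script ends in an effective divisor (`legal_top`). Fix a notion of small set. A maximal script
supported on a small set leads to an equivalent divisor with no nonempty small legal set, provided
smallness survives the relevant unions (`exists_no_small_legal`). In that divisor each chipless
vertex q is avoided by a nonempty legal set, which cannot be small.

When α = n, small means containing no full row. Rows and columns are cliques, and a legal set that
cuts a clique K needs at least |K| - 1 chips on it, with strong restrictions in case of equality
(`Legal.clique_sum_le`, `Legal.tight`). Counting by rows gives closure under unions
(`NoFullRow.union`). Counting by columns shows that a legal set with a full row meets every row
(`Legal.degree_gt`). Hence every row has exactly m - 1 chips, and tightness forces one chip on every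
square off an independent set of size n (`exists_isIndepSet_of_no_small_legal`).

The 2 × 2 and 3 × 3 boards have α < n, so the row count is not available there. Their minimum degree
is so large that the same scheme works with small meaning at most one vertex
(`exists_isMaximumIndepSet_of_minDegree`). -/

namespace ChipFiring

/-! ### Firing scripts, the Laplacian and legal sets -/

section Laplacian

variable {V : Type*} [Fintype V] [DecidableEq V] (G : SimpleGraph V) [DecidableRel G.Adj]

/-- The graph Laplacian: firing every vertex `v` exactly `h v` times turns `D` into
`D - laplacian G h`. -/
def laplacian (h : V → ℤ) : Divisor V := fun v => ∑ w ∈ G.neighborFinset v, (h v - h w)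

/-- Firing all vertices of `U` once leaves no vertex of `U` in debt. -/
def Legal (D : Divisor V) (U : Finset V) : Prop :=
  ∀ v ∈ U, ((G.neighborFinset v \ U).card : ℤ) ≤ D v

theorem laplacian_zero : laplacian G 0 = 0 := by
  funext v; simp [laplacian]

theorem laplacian_add (g h : V → ℤ) : laplacian G (g + h) = laplacian G g + laplacian G h := by
  funext v
  simp only [laplacian, Pi.add_apply, ← Finset.sum_add_distrib]
  exact Finset.sum_congr rfl fun _ _ => by ring

theorem laplacian_neg (h : V → ℤ) : laplacian G (-h) = -laplacian G h := by
  funext v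
  simp only [laplacian, Pi.neg_apply, ← Finset.sum_neg_distrib]
  exact Finset.sum_congr rfl fun _ _ => by ring

theorem laplacian_sub (g h : V → ℤ) : laplacian G (g - h) = laplacian G g - laplacian G h := by
  rw [sub_eq_add_neg, laplacian_add, laplacian_neg, sub_eq_add_neg]

theorem fire_eq_sub_laplacian (v : V) (D : Divisor V) :
    fire G v D = D - laplacian G (Pi.single v 1) := by
  funext w
  simp only [fire, laplacian, Pi.sub_apply]
  rw [Finset.sum_sub_distrib, Finset.sum_pi_single']
  by_cases hw : w = v
  · subst hw
    simp
  · by_cases ha : G.Adj v w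
    · simp [hw, ha, ha.symm]
    · have ha' : ¬ G.Adj w v := fun h => ha h.symm
      simp [hw, ha, ha']

theorem equivalent_refl (D : Divisor V) : Equivalent G D D := (divisorSetoid G).refl D

theorem Equivalent.symm {G : SimpleGraph V} [DecidableRel G.Adj] {D D' : Divisor V}
    (h : Equivalent G D D') : Equivalent G D' D := (divisorSetoid G).symm h

theorem Equivalent.trans {G : SimpleGraph V} [DecidableRel G.Adj] {D D' D'' : Divisor V}
    (h : Equivalent G D D') (h' : Equivalent G D' D'') : Equivalent G D D'' :=
  (divisorSetoid G).trans h h'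

theorem equivalent_sub_laplacian (h : V → ℤ) (D : Divisor V) :
    Equivalent G D (D - laplacian G h) := by
  -- The scripts that preserve equivalence form a subgroup, and the single firings in it generate
  -- all scripts.
  let P : AddSubgroup (V → ℤ) :=
    { carrier := {h | ∀ D, Equivalent G D (D - laplacian G h)}
      zero_mem' := fun D => by
        rw [laplacian_zero, sub_zero]
        exact equivalent_refl G D
      add_mem' := fun {a b} ha hb D => by
        rw [laplacian_add, ← sub_sub]
        exact (ha D).trans (hb _)
      neg_mem' := fun {a} ha D => by
        have := ha (D - laplacian G (-a))
        rw [laplacian_neg, sub_neg_eq_add, add_sub_cancel_right] at this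
        rw [laplacian_neg, sub_neg_eq_add]
        exact this.symm }
  have hsingle : ∀ v : V, Pi.single v (1 : ℤ) ∈ P := fun v D => by
    rw [← fire_eq_sub_laplacian]
    exact Relation.EqvGen.rel _ _ ⟨v, rfl⟩
  have hh : h = ∑ v, h v • Pi.single v (1 : ℤ) := by
    funext w
    simp [Finset.sum_apply, Pi.single_apply]
  have : h ∈ P := by
    rw [hh]
    exact P.sum_mem fun v _ => P.zsmul_mem (hsingle v) _
  exact this D

theorem equivalent_iff {D D' : Divisor V} :
    Equivalent G D D' ↔ ∃ h, D' = D - laplacian G h := by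
  refine ⟨fun h => ?_, ?_⟩
  · change Relation.EqvGen (FireStep G) D D' at h
    induction h with
    | rel _ _ h => obtain ⟨v, rfl⟩ := h; exact ⟨_, fire_eq_sub_laplacian G v _⟩
    | refl _ => exact ⟨0, by rw [laplacian_zero, sub_zero]⟩
    | symm _ _ _ ih =>
      obtain ⟨h, rfl⟩ := ih
      exact ⟨-h, by rw [laplacian_neg]; abel⟩
    | trans _ _ _ _ _ ih1 ih2 =>
      obtain ⟨h, rfl⟩ := ih1
      obtain ⟨g, rfl⟩ := ih2
      exact ⟨h + g, by rw [laplacian_add]; abel⟩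
  · rintro ⟨h, rfl⟩
    exact equivalent_sub_laplacian G h D

/-- At a vertex where `h` is maximal, the Laplacian counts at least the edges to vertices where
`h` is smaller. -/
theorem card_le_laplacian_of_isMax {h : V → ℤ} {M : ℤ} (hM : ∀ w, h w ≤ M) {v : V} (hv : h v = M) :
    ((G.neighborFinset v \ Finset.univ.filter fun w => h w = M).card : ℤ) ≤ laplacian G h v := by
  rw [laplacian, Finset.card_eq_sum_ones, Nat.cast_sum]
  refine le_trans (Finset.sum_le_sum (g := fun w => h v - h w) fun w hw => ?_)
    (Finset.sum_le_sum_of_subset_of_nonneg Finset.sdiff_subset fun w _ _ => ?_)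
  · have h1 : h w ≠ M := by simpa using (Finset.mem_sdiff.1 hw).2
    have := lt_of_le_of_ne (hM w) h1
    push_cast
    omega
  · have := hM w
    omega

/-- A vertex where the script is maximal loses at least one chip along each edge leaving the maximal
level, and it still ends out of debt; so it can already afford firing that level once. -/
theorem legal_top {D D' : Divisor V} {h : V → ℤ} (hD : D' = D - laplacian G h)
    (hE : Effective D') {M : ℤ} (hM : ∀ w, h w ≤ M) :
    Legal G D (Finset.univ.filter fun w => h w = M) := by
  intro v hv
  have h1 := card_le_laplacian_of_isMax G hM (Finset.mem_filter.1 hv).2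
  have h2 := hE v
  rw [hD, Pi.sub_apply] at h2
  omega

theorem laplacian_indicator (U : Finset V) (v : V) :
    laplacian G (fun w => if w ∈ U then 1 else 0) v
      = if v ∈ U then ((G.neighborFinset v \ U).card : ℤ)
        else -((G.neighborFinset v ∩ U).card : ℤ) := by
  rw [laplacian]
  split_ifs with hv
  · have : ∀ w, (1 : ℤ) - (if w ∈ U then 1 else 0) = if w ∉ U then 1 else 0 := fun w => by
      by_cases hw : w ∈ U <;> simp [hw]
    simp only [this, Finset.sum_boole, ← Finset.sdiff_eq_filter]
  · simp only [zero_sub, Finset.sum_neg_distrib, Finset.sum_boole, Finset.filter_mem_eq_inter]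

theorem effective_of_legal {D : Divisor V} (hD : Effective D) {U : Finset V} (hU : Legal G D U) :
    Effective (D - laplacian G fun w => if w ∈ U then 1 else 0) := by
  intro v
  rw [Pi.sub_apply, laplacian_indicator]
  split_ifs with hv
  · exact sub_nonneg.2 (hU v hv)
  · have := hD v
    omega

/-- Maximum principle: a maximum of a harmonic function spreads to all neighbours, hence along
walks. -/
theorem eq_of_laplacian_eq_zero (hG : G.Preconnected) {h : V → ℤ} (h0 : laplacian G h = 0)
    (v w : V) : h v = h w := by
  have : Nonempty V := ⟨v⟩
  obtain ⟨x, hx⟩ := Finite.exists_max h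
  suffices ∀ y, h y = h x by rw [this v, this w]
  intro y
  obtain ⟨p⟩ := hG y x
  induction p with
  | nil => rfl
  | @cons a b c hab p ih =>
    have hb : h b = h c := ih hx
    have hl : laplacian G h b = 0 := by rw [h0]; rfl
    have h1 := card_le_laplacian_of_isMax G hx hb
    rw [hl] at h1
    have h2 : G.neighborFinset b \ Finset.univ.filter (fun w => h w = h c) = ∅ := by
      rw [← Finset.card_eq_zero]; omega
    have h3 := Finset.sdiff_eq_empty_iff_subset.1 h2 ((G.mem_neighborFinset b a).2 hab.symm)
    simpa using h3

theorem Legal.sum_le {G : SimpleGraph V} [DecidableRel G.Adj] {D : Divisor V} {U : Finset V}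
    (hU : Legal G D U) :
    (∑ v ∈ U, ((G.neighborFinset v \ U).card : ℤ)) ≤ ∑ v ∈ U, D v :=
  Finset.sum_le_sum hU

theorem sum_le_degree {D : Divisor V} (hD : Effective D) (U : Finset V) :
    ∑ v ∈ U, D v ≤ degree D :=
  Finset.sum_le_sum_of_subset_of_nonneg (Finset.subset_univ U) fun v _ _ => hD v

theorem finite_effective (d : ℤ) : {D : Divisor V | Effective D ∧ degree D = d}.Finite := by
  refine (Set.finite_Icc (0 : V → ℤ) (fun _ => d)).subset ?_
  rintro D ⟨hD, rfl⟩
  refine ⟨hD, fun v => ?_⟩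
  simpa using sum_le_degree hD {v}

/-- If the union of a legal small set and a small set with legal complement is always small, then
some equivalent effective divisor has no nonempty small legal set. -/
theorem exists_no_small_legal (hG : G.Preconnected) (small : Finset V → Prop) (h_empty : small ∅)
    (h_univ : ¬ small Finset.univ) {D : Divisor V} (hD : Effective D)
    (h_union : ∀ D', Equivalent G D D' → Effective D' → ∀ U A, small U → small A →
      Legal G D' U → Legal G D' Aᶜ → small (A ∪ U)) :
    ∃ D', Equivalent G D D' ∧ Effective D' ∧ ∀ U, small U → Legal G D' U → U = ∅ := by
  let level : (V → ℤ) → Finset V := fun h => Finset.univ.filter fun v => 1 ≤ h v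
  -- Scripts with small support and effective outcome; one with the largest total number of firings
  -- gives the desired divisor.
  let H : Set (V → ℤ) := {h | 0 ≤ h ∧ Effective (D - laplacian G h) ∧ small (level h)}
  have hzero : ∀ h ∈ H, ∃ v, h v = 0 := by
    rintro h ⟨h0, -, hs⟩
    by_contra! hne
    refine h_univ ?_
    convert hs
    symm
    refine Finset.filter_true_of_mem fun v _ => ?_
    have h1 : 0 ≤ h v := h0 v
    have := hne v
    omega
  -- There are finitely many outcomes, and scripts with the same outcome differ by a constant. That
  -- constant is 0, since scripts in `H` are nonnegative and vanish somewhere.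
  have hfin : H.Finite := by
    refine Set.Finite.of_finite_image (f := fun h => D - laplacian G h)
      ((finite_effective (degree D)).subset ?_) ?_
    · rintro _ ⟨h, hh, rfl⟩
      exact ⟨hh.2.1, (degree_eq_of_equivalent G (equivalent_sub_laplacian G h D)).symm⟩
    · intro h hh g hg he
      have h1 : laplacian G (h - g) = 0 := by
        rw [laplacian_sub, sub_eq_zero]
        exact sub_right_injective he
      have h2 := eq_of_laplacian_eq_zero G hG h1
      obtain ⟨v, hv⟩ := hzero h hh
      obtain ⟨w, hw⟩ := hzero g hg
      have h3 : h v - g v = h w - g w := h2 v w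
      have h4 : 0 ≤ g v := hg.1 v
      have h5 : 0 ≤ h w := hh.1 w
      funext x
      have h6 : h x - g x = h w - g w := h2 x w
      omega
  have hne : H.Nonempty := by
    refine ⟨0, le_rfl, ?_, ?_⟩
    · rwa [laplacian_zero, sub_zero]
    · simpa [level] using h_empty
  obtain ⟨h, hh, hmax⟩ := Set.exists_max_image H (fun h => ∑ v, h v) hfin hne
  refine ⟨D - laplacian G h, equivalent_sub_laplacian G h D, hh.2.1, fun U hs hU => ?_⟩
  by_contra hU0
  -- Undoing the script leads back to the effective `D`, and `-h` is maximal exactly off the support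
  -- of `h`.
  have hA : Legal G (D - laplacian G h) (level h)ᶜ := by
    have h1 : (level h)ᶜ = Finset.univ.filter fun v => (-h) v = 0 := by
      ext v
      have : 0 ≤ h v := hh.1 v
      simp only [level, Finset.mem_compl, Finset.mem_filter, Finset.mem_univ, true_and,
        Pi.neg_apply]
      omega
    rw [h1]
    refine legal_top G (D' := D) (by rw [laplacian_neg]; abel) hD fun w => ?_
    have : 0 ≤ h w := hh.1 w
    simpa using this
  have hsu := h_union _ (equivalent_sub_laplacian G h D) hh.2.1 U (level h) hs hh.2.2 hU hA
  -- Firing `U` as well would give a longer script in `H`.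
  have hnew : (h + fun w => if w ∈ U then 1 else 0) ∈ H := by
    refine ⟨fun v => ?_, ?_, ?_⟩
    · have : 0 ≤ h v := hh.1 v
      simp only [Pi.add_apply, Pi.zero_apply]
      split_ifs <;> omega
    · rw [laplacian_add, ← sub_sub]
      exact effective_of_legal G hh.2.1 hU
    · convert hsu using 1
      ext v
      have : 0 ≤ h v := hh.1 v
      by_cases hv : v ∈ U <;> simp [level, hv, this]
  have h1 := hmax _ hnew
  simp only [Pi.add_apply, Finset.sum_add_distrib, Finset.sum_boole, Finset.filter_univ_mem] at h1
  have := Finset.card_pos.2 (Finset.nonempty_iff_ne_empty.2 hU0)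
  omega

end Laplacian

/-! ### Rank, gonality and divisors of independent sets -/

section Rank

variable {V : Type*} [Fintype V] [DecidableEq V] (G : SimpleGraph V) [DecidableRel G.Adj]

theorem degree_nonneg {D : Divisor V} (hD : Effective D) : 0 ≤ degree D :=
  Finset.sum_nonneg fun v _ => hD v

theorem degree_sub (D E : Divisor V) : degree (D - E) = degree D - degree E := by
  simp [degree, Finset.sum_sub_distrib]

theorem degree_single (v : V) (a : ℤ) : degree (Pi.single v a : Divisor V) = a := by
  simp [degree]

theorem effective_single (v : V) {a : ℤ} (ha : 0 ≤ a) : Effective (Pi.single v a : Divisor V) := by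
  intro w
  by_cases h : w = v
  · subst h; simpa
  · simp [h]

theorem Winnable.degree_nonneg {G : SimpleGraph V} [DecidableRel G.Adj] {D : Divisor V}
    (h : Winnable G D) : 0 ≤ degree D := by
  obtain ⟨D', h1, h2⟩ := h
  rw [degree_eq_of_equivalent G h1]
  exact ChipFiring.degree_nonneg h2

theorem Winnable.of_sub {G : SimpleGraph V} [DecidableRel G.Adj] {D E : Divisor V}
    (h : Winnable G (D - E)) (hE : Effective E) : Winnable G D := by
  obtain ⟨D', h1, h2⟩ := h
  obtain ⟨g, rfl⟩ := (equivalent_iff G).1 h1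
  refine ⟨D - laplacian G g, equivalent_sub_laplacian G g D, fun v => ?_⟩
  have := h2 v
  have := hE v
  simp only [Pi.sub_apply] at *
  omega

theorem RankGE.sub_single {G : SimpleGraph V} [DecidableRel G.Adj] {D : Divisor V} {k l : ℕ}
    (h : RankGE G D (k + l)) (v : V) : RankGE G (D - Pi.single v (l : ℤ)) k := by
  intro E hE hk
  have := h (Pi.single v (l : ℤ) + E) (fun w => ?_) ?_
  · rwa [← sub_sub] at this
  · exact add_nonneg (effective_single v (Nat.cast_nonneg l) w) (hE w)
  · have h1 : degree (Pi.single v (l : ℤ) + E) = degree (Pi.single v (l : ℤ) : Divisor V) + degree E := by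
      simp [degree, Finset.sum_add_distrib]
    rw [h1, degree_single, hk]
    push_cast
    ring

theorem RankGE.mono [Nonempty V] {G : SimpleGraph V} [DecidableRel G.Adj] {D : Divisor V} {k l : ℕ}
    (h : RankGE G D l) (hkl : k ≤ l) : RankGE G D k := by
  obtain ⟨j, rfl⟩ := Nat.exists_eq_add_of_le hkl
  obtain ⟨v⟩ := ‹Nonempty V›
  intro E hE hk
  have := h.sub_single v E hE hk
  rw [sub_right_comm] at this
  exact this.of_sub (effective_single v (Nat.cast_nonneg j))

theorem RankGE.le_degree [Nonempty V] {G : SimpleGraph V} [DecidableRel G.Adj] {D : Divisor V}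
    {k : ℕ} (h : RankGE G D k) : (k : ℤ) ≤ degree D := by
  obtain ⟨v⟩ := ‹Nonempty V›
  have := (h (Pi.single v (k : ℤ)) (effective_single v (Nat.cast_nonneg k))
    (degree_single v _)).degree_nonneg
  rw [degree_sub, degree_single] at this
  omega

theorem RankGE.winnable [Nonempty V] {G : SimpleGraph V} [DecidableRel G.Adj] {D : Divisor V}
    {k : ℕ} (h : RankGE G D k) : Winnable G D := by
  have := h.mono (Nat.zero_le k) 0 (fun _ => le_rfl) (by simp [degree])
  rwa [sub_zero] at this

theorem natCast_le_rank_iff [Nonempty V] {D : Divisor V} {k : ℕ} :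
    (k : ℤ) ≤ rank G D ↔ RankGE G D k := by
  have hb : BddAbove {k : ℕ | RankGE G D k} :=
    ⟨(degree D).toNat, fun k hk => by have := RankGE.le_degree hk; omega⟩
  unfold rank
  split_ifs with hw
  · rw [Nat.cast_le]
    refine ⟨fun h => ?_, fun h => le_csSup hb h⟩
    have h0 : RankGE G D 0 := by
      intro E hE h0
      have : E = 0 := by
        funext v
        exact (Finset.sum_eq_zero_iff_of_nonneg fun v _ => hE v).1 h0 v (Finset.mem_univ v)
      rwa [this, sub_zero]
    exact RankGE.mono (Nat.sSup_mem ⟨0, h0⟩ hb) h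
  · refine ⟨fun h => by omega, fun h => absurd h.winnable hw⟩

theorem rank_pos_iff [Nonempty V] {D : Divisor V} : 0 < rank G D ↔ RankGE G D 1 := by
  rw [← natCast_le_rank_iff]
  exact Iff.rfl

theorem gonality_le [Nonempty V] {D : Divisor V} (h : RankGE G D 1) : gonality G ≤ degree D := by
  refine csInf_le ⟨0, ?_⟩ ⟨D, (rank_pos_iff G).2 h, rfl⟩
  rintro _ ⟨D, hD, rfl⟩
  have := ((rank_pos_iff G).1 hD).le_degree
  omega

/-- If the rank were at least 2, removing one chip would leave a divisor of positive rank and degree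
below the gonality. -/
theorem rank_eq_one_iff [Nonempty V] {D : Divisor V} (hD : degree D = gonality G) :
    rank G D = 1 ↔ RankGE G D 1 := by
  rw [← rank_pos_iff]
  refine ⟨fun h => by omega, fun h => le_antisymm ?_ h⟩
  by_contra! h2
  have h3 : RankGE G D 2 := by
    rw [← natCast_le_rank_iff]
    exact h2
  obtain ⟨v⟩ := ‹Nonempty V›
  have h4 := gonality_le G (RankGE.sub_single (k := 1) (l := 1) h3 v)
  rw [degree_sub, degree_single] at h4
  omega

/-- A vertex without chips lies outside some nonempty legal set. -/
theorem exists_legal_of_rankGE_one {G : SimpleGraph V} [DecidableRel G.Adj] {D : Divisor V}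
    (hr : RankGE G D 1) {q : V} (hq : D q = 0) :
    ∃ U : Finset V, U.Nonempty ∧ q ∉ U ∧ Legal G D U := by
  obtain ⟨D', h1, h2⟩ := hr (Pi.single q 1) (effective_single q zero_le_one) (degree_single q 1)
  obtain ⟨g, rfl⟩ := (equivalent_iff G).1 h1
  have hE : Effective (D - laplacian G g) := fun v => by
    have := h2 v
    have := effective_single q zero_le_one v
    simp only [Pi.sub_apply] at *
    omega
  have : Nonempty V := ⟨q⟩
  obtain ⟨x, hx⟩ := Finite.exists_max g
  refine ⟨_, ⟨x, by simp⟩, fun hqU => ?_, legal_top G rfl hE hx⟩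
  -- At a maximum of the script `q` can only lose chips, yet it must end with a chip to spare.
  have h3 := card_le_laplacian_of_isMax G hx (Finset.mem_filter.1 hqU).2
  have h4 := h2 q
  simp only [Pi.sub_apply, hq, Pi.single_eq_same] at h4
  omega

theorem oneOn_compl_apply (S : Finset V) (v : V) :
    oneOn ((S : Set V)ᶜ) v = if v ∈ S then 0 else 1 := by
  by_cases h : v ∈ S <;> simp [oneOn, h]

theorem degree_oneOn_compl (S : Finset V) :
    degree (oneOn ((S : Set V)ᶜ)) = (Fintype.card V : ℤ) - S.card := by
  have : ∀ v, (if v ∈ S then (0 : ℤ) else 1) = 1 - if v ∈ S then 1 else 0 := fun v => by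
    split_ifs <;> rfl
  simp [degree, oneOn_compl_apply, this, Finset.sum_sub_distrib]

theorem rankGE_one_oneOn_compl (hdeg : ∀ v, 0 < G.degree v) {S : Finset V}
    (hS : G.IsIndepSet S) : RankGE G (oneOn ((S : Set V)ᶜ)) 1 := by
  intro E hE hd
  have hsum : ∑ v, E v = 1 := hd
  obtain ⟨v, hv⟩ : ∃ v, E v ≠ 0 := by
    by_contra! h
    simp [h] at hsum
  have hv1 : 0 < E v := lt_of_le_of_ne (hE v) hv.symm
  have hrest : ∀ w, w ≠ v → E w = 0 := fun w hw => by
    have h1 := sum_le_degree hE {v, w}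
    rw [Finset.sum_pair hw.symm, hd] at h1
    have := hE w
    push_cast at h1
    omega
  have hEv : E v = 1 := by
    have h1 := sum_le_degree hE {v}
    rw [Finset.sum_singleton, hd] at h1
    push_cast at h1
    omega
  by_cases hvS : v ∈ S
  -- The vertex `v` borrows: each neighbour pays one chip, and has it because `S` is independent.
  · refine ⟨_, equivalent_sub_laplacian G (-fun w => if w ∈ ({v} : Finset V) then 1 else 0) _,
      fun w => ?_⟩
    rw [laplacian_neg, Pi.sub_apply, Pi.neg_apply, laplacian_indicator, Pi.sub_apply,
      oneOn_compl_apply]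
    by_cases hw : w = v
    · subst hw
      have h1 : G.neighborFinset w \ {w} = G.neighborFinset w :=
        Finset.sdiff_eq_self_of_disjoint (by simp)
      have := hdeg w
      simp only [Finset.mem_singleton, if_true, hvS, h1, hEv, G.card_neighborFinset_eq_degree]
      omega
    · rw [hrest w hw]
      simp only [Finset.mem_singleton, hw, if_false]
      by_cases ha : G.Adj w v
      · have hwS : w ∉ S := fun hwS => hS hwS hvS hw ha
        have h1 : (G.neighborFinset w ∩ {v}).card ≤ 1 :=
          (Finset.card_le_card Finset.inter_subset_right).trans (by simp)
        simp only [hwS, if_false]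
        omega
      · have h1 : G.neighborFinset w ∩ {v} = ∅ :=
          Finset.inter_singleton_of_notMem (by simpa using ha)
        rw [h1]
        split_ifs <;> simp
  · refine ⟨_, equivalent_refl G _, fun w => ?_⟩
    rw [Pi.sub_apply, oneOn_compl_apply]
    by_cases hw : w = v
    · subst hw
      simp [hvS, hEv]
    · rw [hrest w hw]
      split_ifs <;> simp

/-- The gonality is `|V| - α` and its divisor classes come from maximum independent sets, as soon
as this holds for all divisors of positive rank and small degree. -/
theorem gonality_eq_and_bijOn [Nonempty V] (hdeg : ∀ v, 0 < G.degree v)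
    (hinj : ∀ S T : Finset V,
      Equivalent G (oneOn ((S : Set V)ᶜ)) (oneOn ((T : Set V)ᶜ)) → S = T)
    (hclass : ∀ D : Divisor V, Effective D → RankGE G D 1 →
      degree D ≤ (Fintype.card V : ℤ) - G.indepNum →
      ∃ S : Finset V, G.IsMaximumIndepSet S ∧ Equivalent G D (oneOn ((S : Set V)ᶜ))) :
    gonality G = (Fintype.card V : ℤ) - G.indepNum ∧
    Set.BijOn (fun S : Finset V => divisorClass G (oneOn ((S : Set V)ᶜ)))
      {S | G.IsMaximumIndepSet S}
      {c | classRank G c = 1 ∧ classDegree G c = gonality G} := by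
  have hmaxdeg : ∀ S : Finset V, G.IsMaximumIndepSet S →
      degree (oneOn ((S : Set V)ᶜ)) = (Fintype.card V : ℤ) - G.indepNum := fun S hS => by
    rw [degree_oneOn_compl, G.maximumIndepSet_card_eq_indepNum S hS]
  have hclass' : ∀ D : Divisor V, RankGE G D 1 → degree D ≤ (Fintype.card V : ℤ) - G.indepNum →
      ∃ S : Finset V, G.IsMaximumIndepSet S ∧ Equivalent G D (oneOn ((S : Set V)ᶜ)) := by
    intro D hr hd
    obtain ⟨D', h1, h2⟩ := hr.winnable
    have hr' : RankGE G D' 1 := by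
      rw [← rank_pos_iff, ← rank_eq_of_equivalent G h1, rank_pos_iff]
      exact hr
    rw [degree_eq_of_equivalent G h1] at hd
    obtain ⟨S, hS, h3⟩ := hclass D' h2 hr' hd
    exact ⟨S, hS, h1.trans h3⟩
  have hgon : gonality G = (Fintype.card V : ℤ) - G.indepNum := by
    obtain ⟨S, hS⟩ := G.maximumIndepSet_exists
    have hrS := rankGE_one_oneOn_compl G hdeg hS.isIndepSet
    refine le_antisymm ((gonality_le G hrS).trans_eq (hmaxdeg S hS)) ?_
    refine le_csInf ⟨_, _, (rank_pos_iff G).2 hrS, rfl⟩ ?_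
    rintro _ ⟨D, hD, rfl⟩
    by_contra! hlt
    obtain ⟨T, hT, h1⟩ := hclass' D ((rank_pos_iff G).1 hD) hlt.le
    rw [degree_eq_of_equivalent G h1, hmaxdeg T hT] at hlt
    exact lt_irrefl _ hlt
  refine ⟨hgon, ?_, ?_, ?_⟩
  · intro S hS
    have h1 : degree (oneOn ((S : Set V)ᶜ)) = gonality G := (hmaxdeg S hS).trans hgon.symm
    exact ⟨(rank_eq_one_iff G h1).2 (rankGE_one_oneOn_compl G hdeg hS.isIndepSet), h1⟩
  · intro S _ T _ h
    exact hinj S T (Quotient.exact (s := divisorSetoid G) h)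
  · intro c
    induction c using Quotient.inductionOn with
    | h D =>
      rintro ⟨h1, h2⟩
      change rank G D = 1 at h1
      change degree D = gonality G at h2
      obtain ⟨S, hS, h3⟩ := hclass' D ((rank_eq_one_iff G h2).1 h1) (h2.trans hgon).le
      exact ⟨S, hS, Quotient.sound (s := divisorSetoid G) h3.symm⟩

/-- If every cut with at least two vertices on both sides has more than `deg D` edges and any two
distinct vertices together have many neighbours, then `D` comes from an independent set. -/
theorem exists_isMaximumIndepSet_of_large_cuts (hG : G.Preconnected) (hcard : 2 ≤ Fintype.card V)
    {D : Divisor V} (hD : Effective D) (hr : RankGE G D 1)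
    (hd : degree D ≤ (Fintype.card V : ℤ) - G.indepNum)
    (hcut : ∀ U : Finset V, 2 ≤ U.card → 2 ≤ Uᶜ.card →
      degree D < ∑ v ∈ U, ((G.neighborFinset v \ U).card : ℤ))
    (hpair : ∀ v w, v ≠ w → degree D + 1 < (G.degree v : ℤ) + G.degree w) :
    ∃ S : Finset V, G.IsMaximumIndepSet S ∧ Equivalent G D (oneOn ((S : Set V)ᶜ)) := by
  have hlegal_single : ∀ {D' : Divisor V} {v : V}, Legal G D' {v} → (G.degree v : ℤ) ≤ D' v := by
    intro D' v h
    have := h v (Finset.mem_singleton_self v)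
    rwa [Finset.sdiff_eq_self_of_disjoint (by simp), G.card_neighborFinset_eq_degree] at this
  have hlegal_compl : ∀ {D' : Divisor V} {a w : V}, Legal G D' {a}ᶜ → G.Adj w a → 1 ≤ D' w := by
    intro D' a w h haw
    refine le_trans ?_ (h w (by simpa using haw.ne))
    have : a ∈ G.neighborFinset w \ {a}ᶜ := by simpa using haw
    exact_mod_cast Finset.card_pos.2 ⟨a, this⟩
  obtain ⟨D', h1, h2, h3⟩ := exists_no_small_legal G hG (fun U => U.card ≤ 1) (by simp)
    (by simpa [Nat.lt_iff_add_one_le] using hcard) hD (by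
      -- The union can only fail to be small for two distinct singletons {v} and {a}. Then `v` holds
      -- at least deg v chips and every neighbour of `a` at least one; allowing for the overlap at
      -- `v`, this is at least deg v + deg a - 1, too many by `hpair`.
      intro D' h1 h2 U A hU hA hlU hlA
      by_contra hUA
      have hU1 : U.card = 1 := by
        have := Finset.card_union_le A U
        omega
      have hA1 : A.card = 1 := by
        have := Finset.card_union_le A U
        omega
      obtain ⟨v, rfl⟩ := Finset.card_eq_one.1 hU1
      obtain ⟨a, rfl⟩ := Finset.card_eq_one.1 hA1
      have hav : v ≠ a := by
        rintro rfl
        simp at hUA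
      have hv := hlegal_single hlU
      have hsum : ∑ w ∈ G.neighborFinset a \ {v}, (1 : ℤ) ≤ ∑ w ∈ G.neighborFinset a \ {v}, D' w :=
        Finset.sum_le_sum fun w hw =>
          hlegal_compl hlA ((G.mem_neighborFinset a w).1 (Finset.mem_sdiff.1 hw).1).symm
      have htot := sum_le_degree h2 (insert v (G.neighborFinset a \ {v}))
      rw [Finset.sum_insert (by simp), ← degree_eq_of_equivalent G h1] at htot
      have hc : G.degree a ≤ (G.neighborFinset a \ {v}).card + 1 := by
        rw [← G.card_neighborFinset_eq_degree]
        have := Finset.le_card_sdiff {v} (G.neighborFinset a)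
        simp only [Finset.card_singleton] at this
        omega
      have := hpair v a hav
      simp only [Finset.sum_const, mul_one, nsmul_eq_mul] at hsum
      omega)
  have hr' : RankGE G D' 1 := by
    have : Nonempty V := Fintype.card_pos_iff.1 (by omega)
    rw [← rank_pos_iff, ← rank_eq_of_equivalent G h1, rank_pos_iff]
    exact hr
  -- A legal set avoiding a chipless `q` is not small, and by `hcut` it misses at most one vertex,
  -- so it is the complement of {q}. Firing it costs each neighbour of `q` a chip.
  have hnbr : ∀ q w, D' q = 0 → G.Adj w q → 1 ≤ D' w := by
    intro q w hq hwq
    obtain ⟨U, hUne, hqU, hlU⟩ := exists_legal_of_rankGE_one hr' hq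
    have hUc : Uᶜ.card ≤ 1 := by
      by_contra! hc
      have h4 : 2 ≤ U.card := by
        by_contra! hc'
        exact hUne.ne_empty (h3 U (by omega) hlU)
      have h5 := hcut U h4 hc
      have h6 := hlU.sum_le.trans (sum_le_degree h2 U)
      rw [← degree_eq_of_equivalent G h1] at h6
      omega
    have hq' : Uᶜ = {q} :=
      (Finset.eq_of_subset_of_card_le (by simpa using hqU) (by simpa using hUc)).symm
    rw [← compl_compl U, hq'] at hlU
    exact hlegal_compl hlU hwq
  let Z : Finset V := Finset.univ.filter fun v => D' v = 0
  have hZ : G.IsIndepSet Z := by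
    intro v hv w hw _ ha
    have hv' : D' v = 0 := by simpa [Z] using hv
    have hw' : D' w = 0 := by simpa [Z] using hw
    have := hnbr w v hw' ha
    omega
  have hpos : ∀ v, oneOn ((Z : Set V)ᶜ) v ≤ D' v := by
    intro v
    rw [oneOn_compl_apply]
    have := h2 v
    by_cases hv : D' v = 0
    · simp [Z, hv]
    · simp only [Z, Finset.mem_filter, Finset.mem_univ, hv, and_false, if_false]
      omega
  have hZle := hZ.card_le_indepNum
  have hle : degree (oneOn ((Z : Set V)ᶜ)) ≤ degree D' := Finset.sum_le_sum fun v _ => hpos v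
  rw [degree_oneOn_compl] at hle
  rw [degree_eq_of_equivalent G h1] at hd
  refine ⟨Z, ⟨hZ, fun T hT => ?_⟩, ?_⟩
  · have := hT.card_le_indepNum
    omega
  · have heq : D' = oneOn ((Z : Set V)ᶜ) := by
      have h4 : degree (oneOn ((Z : Set V)ᶜ)) = degree D' := by
        rw [degree_oneOn_compl]
        omega
      funext v
      exact ((Finset.sum_eq_sum_iff_of_le fun v _ => hpos v).1 h4 v (Finset.mem_univ v)).symm
    rwa [← heq]

end Rank

/-! ### Legal sets that cut cliques -/

section Clique

variable {V : Type*} [Fintype V] [DecidableEq V] {G : SimpleGraph V} [DecidableRel G.Adj]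

/-- The chips that a legal set `U` needs on a clique `K`. -/
theorem Legal.clique_sum_le {D : Divisor V} {U : Finset V} (hU : Legal G D U) (hD : Effective D)
    {K : Finset V} (hK : G.IsClique K) :
    ((K ∩ U).card : ℤ) * (K \ U).card + ∑ v ∈ K ∩ U, (((G.neighborFinset v \ U) \ K).card : ℤ)
      ≤ ∑ v ∈ K, D v := by
  refine le_trans ?_ (Finset.sum_le_sum_of_subset_of_nonneg (s := K ∩ U)
    Finset.inter_subset_left fun v _ _ => hD v)
  rw [← nsmul_eq_mul, ← Finset.sum_const, ← Finset.sum_add_distrib]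
  refine Finset.sum_le_sum fun v hv => le_trans ?_ (hU v (Finset.mem_inter.1 hv).2)
  have hdisj : Disjoint (K \ U) ((G.neighborFinset v \ U) \ K) :=
    Finset.disjoint_left.2 fun w hw hw' => (Finset.mem_sdiff.1 hw').2 (Finset.mem_sdiff.1 hw).1
  rw [← Nat.cast_add, ← Finset.card_union_of_disjoint hdisj]
  refine Nat.cast_le.2 (Finset.card_le_card fun w hw => ?_)
  rcases Finset.mem_union.1 hw with hw | hw
  · obtain ⟨hwK, hwU⟩ := Finset.mem_sdiff.1 hw
    obtain ⟨hvK, hvU⟩ := Finset.mem_inter.1 hv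
    refine Finset.mem_sdiff.2 ⟨(G.mem_neighborFinset v w).2 (hK hvK hwK ?_), hwU⟩
    rintro rfl
    exact hwU hvU
  · exact (Finset.mem_sdiff.1 hw).1

/-- For positive integers a, b one has (a - 1)(b - 1) ≥ 0, that is, ab ≥ a + b - 1. -/
theorem card_sub_one_le_mul {K U : Finset V} (hKU : (K ∩ U).Nonempty) (hKU' : (K \ U).Nonempty) :
    (K.card : ℤ) - 1 ≤ ((K ∩ U).card : ℤ) * (K \ U).card := by
  have h1 := Finset.card_inter_add_card_sdiff K U
  have h2 := hKU.card_pos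
  have h3 := hKU'.card_pos
  rw [← h1]
  push_cast
  nlinarith

theorem Legal.card_sub_one_le {D : Divisor V} {U : Finset V} (hU : Legal G D U) (hD : Effective D)
    {K : Finset V} (hK : G.IsClique K) (hKU : (K ∩ U).Nonempty) (hKU' : (K \ U).Nonempty) :
    (K.card : ℤ) - 1 ≤ ∑ v ∈ K, D v := by
  have h1 := hU.clique_sum_le hD hK
  have h2 := card_sub_one_le_mul hKU hKU'
  have h3 : (0 : ℤ) ≤ ∑ v ∈ K ∩ U, (((G.neighborFinset v \ U) \ K).card : ℤ) :=
    Finset.sum_nonneg fun _ _ => Nat.cast_nonneg _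
  omega

/-- If a clique has only just enough chips for being cut by a legal set, then all cut edges at its
fired vertices lie inside the clique, and the cut is the smallest possible. -/
theorem Legal.tight {D : Divisor V} {U : Finset V} (hU : Legal G D U) (hD : Effective D)
    {K : Finset V} (hK : G.IsClique K) (hKU : (K ∩ U).Nonempty) (hKU' : (K \ U).Nonempty)
    (hS : ∑ v ∈ K, D v ≤ (K.card : ℤ) - 1) :
    (∀ v ∈ K, v ∈ U → ∀ w, w ∉ U → G.Adj v w → w ∈ K) ∧
      ((K ∩ U).card = 1 ∨ (K \ U).card = 1) := by
  have h1 := hU.clique_sum_le hD hK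
  have h2 := card_sub_one_le_mul hKU hKU'
  have h3 : ∀ v ∈ K ∩ U, (0 : ℤ) ≤ (((G.neighborFinset v \ U) \ K).card : ℤ) :=
    fun _ _ => Nat.cast_nonneg _
  have h4 := Finset.sum_nonneg h3
  refine ⟨fun v hvK hvU w hwU hvw => ?_, ?_⟩
  · have h5 := (Finset.sum_eq_zero_iff_of_nonneg h3).1 (by omega) v
      (Finset.mem_inter.2 ⟨hvK, hvU⟩)
    have h6 : (G.neighborFinset v \ U) \ K = ∅ := by
      rw [← Finset.card_eq_zero]
      exact_mod_cast h5
    by_contra hwK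
    have : w ∈ (G.neighborFinset v \ U) \ K := by simp [hvw, hwU, hwK]
    simp [h6] at this
  · have h5 := Finset.card_inter_add_card_sdiff K U
    have h6 := hKU.card_pos
    have h7 := hKU'.card_pos
    -- Writing a, b for the two sizes, this says (a - 1)(b - 1) ≤ 0, so one of them is 1.
    have h8 : ((K ∩ U).card : ℤ) * (K \ U).card ≤ (K ∩ U).card + (K \ U).card - 1 := by
      rw [← h5] at hS
      push_cast at hS
      omega
    by_contra! hne
    have h9 : (2 : ℤ) ≤ (K ∩ U).card := by omega
    have h10 : (2 : ℤ) ≤ (K \ U).card := by omega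
    nlinarith

end Clique

/-! ### Rows and columns of the queen's graph -/

section Queen

variable {m n : ℕ}

theorem queen_adj {i k : Fin m} {j l : Fin n} :
    (queenGraph m n).Adj (i, j) (k, l) ↔ ¬((i : ℕ) = k ∧ (j : ℕ) = l) ∧
      ((i : ℕ) = k ∨ (j : ℕ) = l ∨ (j : ℕ) + k = l + i ∨ (j : ℕ) + i = l + k) := by
  simp only [queenGraph, ne_eq, Prod.mk.injEq, Fin.ext_iff]
  omega

/-- The squares of a row of the board. -/
def row (m : ℕ) {n : ℕ} (j : Fin n) : Finset (Fin m × Fin n) :=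
  Finset.univ.filter fun v => v.2 = j

/-- The squares of a column of the board. -/
def col {m : ℕ} (n : ℕ) (i : Fin m) : Finset (Fin m × Fin n) :=
  Finset.univ.filter fun v => v.1 = i

theorem mem_row {j : Fin n} {v : Fin m × Fin n} : v ∈ row m j ↔ v.2 = j := by simp [row]

theorem mem_col {i : Fin m} {v : Fin m × Fin n} : v ∈ col n i ↔ v.1 = i := by simp [col]

theorem row_eq_map (j : Fin n) :
    row m j = Finset.univ.map (Function.Embedding.sectL (Fin m) j) := by
  ext ⟨i, l⟩
  simp [row, eq_comm]

theorem col_eq_map (i : Fin m) :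
    col n i = Finset.univ.map (Function.Embedding.sectR i (Fin n)) := by
  ext ⟨k, l⟩
  simp [col, eq_comm]

theorem card_row (j : Fin n) : (row m j).card = m := by simp [row_eq_map]

theorem card_col (i : Fin m) : (col n i).card = n := by simp [col_eq_map]

theorem isClique_row (j : Fin n) : (queenGraph m n).IsClique (row m j) := by
  rintro ⟨i, l⟩ h ⟨k, l'⟩ h' hne
  rw [Finset.mem_coe, mem_row] at h h'
  simp only at h h'
  subst h
  subst h'
  exact ⟨hne, Or.inr (Or.inl rfl)⟩

theorem isClique_col (i : Fin m) : (queenGraph m n).IsClique (col n i) := by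
  rintro ⟨k, l⟩ h ⟨k', l'⟩ h' hne
  rw [Finset.mem_coe, mem_col] at h h'
  simp only at h h'
  subst h
  subst h'
  exact ⟨hne, Or.inl rfl⟩

theorem degree_eq_sum_row (D : Divisor (Fin m × Fin n)) : degree D = ∑ j, ∑ v ∈ row m j, D v :=
  (Finset.sum_fiberwise Finset.univ Prod.snd D).symm

theorem degree_eq_sum_col (D : Divisor (Fin m × Fin n)) : degree D = ∑ i, ∑ v ∈ col n i, D v :=
  (Finset.sum_fiberwise Finset.univ Prod.fst D).symm

theorem queen_preconnected : (queenGraph m n).Preconnected := by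
  rintro ⟨i, j⟩ ⟨k, l⟩
  have h1 : (queenGraph m n).Reachable (i, j) (i, l) := by
    by_cases h : j = l
    · subst h; exact .refl _
    · exact SimpleGraph.Adj.reachable ⟨by simpa using h, Or.inl rfl⟩
  have h2 : (queenGraph m n).Reachable (i, l) (k, l) := by
    by_cases h : i = k
    · subst h; exact .refl _
    · exact SimpleGraph.Adj.reachable ⟨by simpa using h, Or.inr (Or.inl rfl)⟩
  exact h1.trans h2

theorem forall_fin_iff_of_step {N : ℕ} {P : Fin N → Prop}
    (h : ∀ i k : Fin N, (k : ℕ) = i + 1 → (P i ↔ P k)) (a b : Fin N) : P a ↔ P b := by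
  have key : ∀ (t : ℕ) (i k : Fin N), (k : ℕ) = i + t → (P i ↔ P k) := by
    intro t
    induction t with
    | zero =>
      intro i k hk
      rw [show k = i from Fin.ext (by simpa using hk)]
    | succ t ih =>
      intro i k hk
      let l : Fin N := ⟨i + t, by omega⟩
      exact (ih i l rfl).trans (h l k hk)
  rcases le_total (a : ℕ) b with hab | hab
  · exact key (b - a) a b (by omega)
  · exact (key (a - b) b a (by omega)).symm

theorem exists_adjacent_row (hn : 2 ≤ n) (j : Fin n) :
    ∃ l : Fin n, (l : ℕ) = j + 1 ∨ (j : ℕ) = l + 1 := by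
  by_cases h : (j : ℕ) + 1 < n
  · exact ⟨⟨j + 1, h⟩, Or.inl rfl⟩
  · exact ⟨⟨j - 1, by omega⟩, Or.inr (by simp; omega)⟩

theorem exists_adjacent_col (hm : 2 ≤ m) (i : Fin m) :
    ∃ k : Fin m, (k : ℕ) = i + 1 ∨ (i : ℕ) = k + 1 := exists_adjacent_row hm i

/-- A legal set that cuts a row with at most `m - 1` chips. -/
theorem Legal.row_tight {D : Divisor (Fin m × Fin n)} {U : Finset (Fin m × Fin n)}
    (hU : Legal (queenGraph m n) D U) (hD : Effective D) {j : Fin n}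
    (hS : ∑ v ∈ row m j, D v ≤ (m : ℤ) - 1) {a b : Fin m} (ha : (a, j) ∈ U) (hb : (b, j) ∉ U) :
    (∀ i k l, (i, j) ∈ U → (k, l) ∉ U → (queenGraph m n).Adj (i, j) (k, l) → l = j) ∧
      ((row m j ∩ U).card = 1 ∨ (row m j \ U).card = 1) := by
  obtain ⟨h1, h2⟩ := hU.tight hD (isClique_row j) ⟨(a, j), by simp [mem_row, ha]⟩
    ⟨(b, j), by simp [mem_row, hb]⟩ (by rwa [card_row])
  exact ⟨fun i k l hi hk hadj => mem_row.1 (h1 (i, j) (mem_row.2 rfl) hi (k, l) hk hadj), h2⟩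

theorem Legal.row_sum_ge {D : Divisor (Fin m × Fin n)} {U : Finset (Fin m × Fin n)}
    (hU : Legal (queenGraph m n) D U) (hD : Effective D) {j : Fin n}
    {a b : Fin m} (ha : (a, j) ∈ U) (hb : (b, j) ∉ U) :
    (m : ℤ) - 1 ≤ ∑ v ∈ row m j, D v := by
  have := hU.card_sub_one_le hD (isClique_row j) ⟨(a, j), by simp [mem_row, ha]⟩
    ⟨(b, j), by simp [mem_row, hb]⟩
  rwa [card_row] at this

/-- A set of squares without a full row. -/
def NoFullRow (U : Finset (Fin m × Fin n)) : Prop := ∀ j, ∃ i, (i, j) ∉ U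

/-- A legal set without a full row cannot meet one of two neighbouring rows with at most `m - 1`
chips each. -/
theorem Legal.notMem_of_adjacent_rows {D : Divisor (Fin m × Fin n)} {U : Finset (Fin m × Fin n)}
    (hU : Legal (queenGraph m n) D U) (hD : Effective D) (hs : NoFullRow U) {j l : Fin n}
    (hjl : (l : ℕ) = j + 1 ∨ (j : ℕ) = l + 1) (hj : ∑ v ∈ row m j, D v ≤ (m : ℤ) - 1)
    (hl : ∑ v ∈ row m l, D v ≤ (m : ℤ) - 1) (a : Fin m) : (a, j) ∉ U := by
  intro ha
  obtain ⟨b, hb⟩ := hs j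
  obtain ⟨c, hc⟩ := hs l
  have hne : j ≠ l := by
    rintro rfl
    omega
  have hj' := (hU.row_tight hD hj ha hb).1
  -- By tightness no edge leaving `U` from row `j` goes to row `l`, so `U` contains all neighbours
  -- in row `l` of its squares in row `j`. With the vertical edges back, membership in `U` spreads
  -- step by step along row `j`, which then is full.
  have hup : ∀ i k : Fin m, (i : ℕ) = k ∨ (k : ℕ) = i + 1 ∨ (i : ℕ) = k + 1 →
      (i, j) ∈ U → (k, l) ∈ U := by
    intro i k hik hi
    by_contra hk
    exact hne (hj' i k l hi hk (queen_adj.2 (by omega))).symm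
  have hl' := (hU.row_tight hD hl (hup a a (Or.inl rfl) ha) hc).1
  have hdown : ∀ i : Fin m, (i, l) ∈ U → (i, j) ∈ U := by
    intro i hi
    by_contra hk
    exact hne (hl' i i j hi hk (queen_adj.2 (by omega)))
  refine hb ((forall_fin_iff_of_step (P := fun i => (i, j) ∈ U) (fun i k hik => ?_) a b).1 ha)
  exact ⟨fun h => hdown k (hup i k (by omega) h), fun h => hdown i (hup k i (by omega) h)⟩

/-- A legal set without a full row and the complement of a legal set cannot together fill a row. -/
theorem NoFullRow.union {D : Divisor (Fin m × Fin n)} (hn : 2 ≤ n) (hD : Effective D)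
    (hd : degree D ≤ (n : ℤ) * (m - 1)) {U A : Finset (Fin m × Fin n)} (hsU : NoFullRow U)
    (hsA : NoFullRow A) (hU : Legal (queenGraph m n) D U) (hA : Legal (queenGraph m n) D Aᶜ) :
    NoFullRow (A ∪ U) := by
  intro r
  by_contra! hr
  obtain ⟨a, haA⟩ := hsA r
  have haU : (a, r) ∈ U := (Finset.mem_union.1 (hr a)).resolve_left haA
  obtain ⟨b, hbU⟩ := hsU r
  -- The rows met by neither set are the only ones not cut, and row `r` makes up for their deficit.
  -- With u squares of `U` in row `r`, that row holds at least m - 1 + u|T| chips, a row of `T` at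
  -- least m - u, and any other row at least m - 1. Altogether this is at least n(m - 1) + |T|, so
  -- `T` is empty and every row holds exactly m - 1 chips.
  let T : Finset (Fin n) := Finset.univ.filter fun j => ∀ i, (i, j) ∉ A ∧ (i, j) ∉ U
  have hrT : r ∉ T := fun h => ((Finset.mem_filter.1 h).2 a).2 haU
  let u : ℤ := (row m r ∩ U).card
  have hu : 1 ≤ u := by
    have : 0 < (row m r ∩ U).card := Finset.card_pos.2 ⟨(a, r), by simp [mem_row, haU]⟩
    change 1 ≤ ((row m r ∩ U).card : ℤ)
    omega
  have hcard : u + ((row m r \ U).card : ℤ) = m := by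
    have h := Finset.card_inter_add_card_sdiff (row m r) U
    rw [card_row] at h
    change ((row m r ∩ U).card : ℤ) + _ = _
    exact_mod_cast h
  have hR : (m : ℤ) - 1 + u * T.card ≤ ∑ v ∈ row m r, D v := by
    have h1 := hU.clique_sum_le hD (isClique_row r)
    have h2 := card_sub_one_le_mul (K := row m r) (U := U) ⟨(a, r), by simp [mem_row, haU]⟩
      ⟨(b, r), by simp [mem_row, hbU]⟩
    rw [card_row] at h2
    -- Each square of `U` in row `r` has a vertical edge leaving `U` to every row of `T`.
    have h3 : u * T.card ≤
        ∑ v ∈ row m r ∩ U, ((((queenGraph m n).neighborFinset v \ U) \ row m r).card : ℤ) := by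
      have hconst : u * T.card = ∑ _v ∈ row m r ∩ U, (T.card : ℤ) := by
        rw [Finset.sum_const, nsmul_eq_mul]
      rw [hconst]
      refine Finset.sum_le_sum ?_
      rintro ⟨i, l⟩ hi
      simp only [Finset.mem_inter, mem_row] at hi
      obtain ⟨rfl, hiU⟩ := hi
      rw [← Finset.card_map (Function.Embedding.sectR i (Fin n)), Nat.cast_le]
      refine Finset.card_le_card fun w hw => ?_
      obtain ⟨j, hj, rfl⟩ := Finset.mem_map.1 hw
      have hjl : j ≠ l := fun h => hrT (h ▸ hj)
      have hjl' : (j : ℕ) ≠ l := fun h => hjl (Fin.ext h)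
      simp only [Function.Embedding.sectR_apply, Finset.mem_sdiff,
        SimpleGraph.mem_neighborFinset, mem_row]
      exact ⟨⟨queen_adj.2 (by omega), ((Finset.mem_filter.1 hj).2 i).2⟩, hjl⟩
    omega
  have hT : ∀ j ∈ T, (m : ℤ) - u ≤ ∑ v ∈ row m j, D v := by
    intro j hj
    have hjT := (Finset.mem_filter.1 hj).2
    -- A square of row `r` off `U` lies in `A`; the square of row `j` in the same column lies off
    -- `A` next to it and so needs a chip.
    have h1 : ((row m r \ U).card : ℤ) ≤ ∑ v ∈ row m r \ U, D (v.1, j) := by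
      rw [Finset.card_eq_sum_ones, Nat.cast_sum]
      refine Finset.sum_le_sum ?_
      rintro ⟨i, l⟩ hi
      simp only [Finset.mem_sdiff, mem_row] at hi
      obtain ⟨rfl, hiU⟩ := hi
      have hiA : (i, l) ∈ A := (Finset.mem_union.1 (hr i)).resolve_right hiU
      refine le_trans ?_ (hA (i, j) (by simpa using (hjT i).1))
      have : (i, l) ∈ (queenGraph m n).neighborFinset (i, j) \ Aᶜ := by
        have hjl : (j : ℕ) ≠ l := fun h => hrT (by rwa [← Fin.ext h])
        simp only [Finset.mem_sdiff, SimpleGraph.mem_neighborFinset, Finset.mem_compl, not_not]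
        exact ⟨queen_adj.2 (by omega), hiA⟩
      exact_mod_cast Finset.card_pos.2 ⟨_, this⟩
    have h2 : ∑ v ∈ row m r \ U, D (v.1, j) ≤ ∑ v ∈ row m r, D (v.1, j) :=
      Finset.sum_le_sum_of_subset_of_nonneg Finset.sdiff_subset fun v _ _ => hD _
    have h3 : ∑ v ∈ row m r, D (v.1, j) = ∑ v ∈ row m j, D v := by
      simp [row_eq_map]
    omega
  have hother : ∀ j, j ∉ T → (m : ℤ) - 1 ≤ ∑ v ∈ row m j, D v := by
    intro j hj
    simp only [T, Finset.mem_filter, Finset.mem_univ, true_and, not_forall] at hj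
    obtain ⟨i, hi⟩ := hj
    by_cases hiU : (i, j) ∈ U
    · obtain ⟨k, hk⟩ := hsU j
      exact hU.row_sum_ge hD hiU hk
    · have hiA : (i, j) ∈ A := by tauto
      obtain ⟨k, hk⟩ := hsA j
      exact hA.row_sum_ge hD (a := k) (b := i) (by simpa using hk) (by simpa using hiA)
  have hrow : ∀ j, (if j = r then u * T.card else 0) - (if j ∈ T then u - 1 else 0)
      ≤ ∑ v ∈ row m j, D v - ((m : ℤ) - 1) := by
    intro j
    by_cases hjr : j = r
    · subst hjr
      simp only [if_true, hrT, if_false]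
      omega
    · by_cases hj : j ∈ T
      · have := hT j hj
        simp only [hjr, hj, if_true, if_false]
        omega
      · have := hother j hj
        simp only [hjr, hj, if_false]
        omega
  have hsum := Finset.sum_le_sum fun j (_ : j ∈ Finset.univ) => hrow j
  have hexcess : ∑ j, (∑ v ∈ row m j, D v - ((m : ℤ) - 1)) ≤ 0 := by
    rw [Finset.sum_sub_distrib, ← degree_eq_sum_row]
    simp only [Finset.sum_const, Finset.card_univ, Fintype.card_fin, nsmul_eq_mul]
    omega
  have hT0 : T = ∅ := by
    rw [Finset.sum_sub_distrib, Finset.sum_ite_eq' Finset.univ r, ← Finset.sum_filter,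
      Finset.filter_univ_mem, Finset.sum_const, nsmul_eq_mul] at hsum
    simp only [Finset.mem_univ, if_true] at hsum
    rw [← Finset.card_eq_zero]
    have : (T.card : ℤ) ≤ 0 := by linarith
    omega
  have hge : ∀ j, 0 ≤ ∑ v ∈ row m j, D v - ((m : ℤ) - 1) := fun j => by
    have := hother j (by simp [hT0])
    omega
  have hle : ∀ j, ∑ v ∈ row m j, D v ≤ (m : ℤ) - 1 := fun j => by
    have := Finset.single_le_sum (fun j _ => hge j) (Finset.mem_univ j)
    omega
  obtain ⟨l, hl⟩ := exists_adjacent_row hn r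
  exact hU.notMem_of_adjacent_rows hD hsU hl (hle r) (hle l) a haU

/-- A legal set that contains a row and misses a row needs many chips. -/
theorem Legal.degree_gt {D : Divisor (Fin m × Fin n)} (hmn : n ≤ m) (hD : Effective D)
    {U : Finset (Fin m × Fin n)} (hU : Legal (queenGraph m n) D U) {r t : Fin n}
    (hr : ∀ i, (i, r) ∈ U) (ht : ∀ i, (i, t) ∉ U) : (n : ℤ) * (m - 1) < degree D := by
  -- Truncated subtraction makes this |r - t|.
  let k : ℕ := (r - t) + (t - r)
  have hne : (r : ℕ) ≠ t := fun h => by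
    have hi : 0 < m := r.pos.trans_le hmn
    exact ht ⟨0, hi⟩ (Fin.ext h ▸ hr ⟨0, hi⟩)
  -- Every column is cut. In the first m - k columns the square in row `r` also has a diagonal edge
  -- to row `t`, which leaves both `U` and the column.
  have hcol : ∀ i : Fin m, (n : ℤ) - 1 + (if (i : ℕ) < m - k then 1 else 0)
      ≤ ∑ v ∈ col n i, D v := by
    intro i
    have hir : (i, r) ∈ col n i ∩ U := by simp [mem_col, hr]
    have h1 := hU.clique_sum_le hD (isClique_col i)
    have h2 := card_sub_one_le_mul ⟨_, hir⟩ ⟨(i, t), by simp [mem_col, ht]⟩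
    rw [card_col] at h2
    have h3 := Finset.single_le_sum
      (f := fun v => ((((queenGraph m n).neighborFinset v \ U) \ col n i).card : ℤ))
      (fun _ _ => Nat.cast_nonneg _) hir
    have h4 : (if (i : ℕ) < m - k then (1 : ℤ) else 0)
        ≤ ((((queenGraph m n).neighborFinset (i, r) \ U) \ col n i).card : ℤ) := by
      split_ifs with hi
      · have : ((⟨i + k, by omega⟩, t) : Fin m × Fin n)
            ∈ ((queenGraph m n).neighborFinset (i, r) \ U) \ col n i := by
          simp only [Finset.mem_sdiff, SimpleGraph.mem_neighborFinset, mem_col, Fin.ext_iff]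
          exact ⟨⟨queen_adj.2 (by simp only; omega), ht _⟩, by omega⟩
        exact_mod_cast Finset.card_pos.2 ⟨_, this⟩
      · exact Nat.cast_nonneg _
    omega
  have hsum := Finset.sum_le_sum fun i (_ : i ∈ Finset.univ) => hcol i
  rw [← degree_eq_sum_col, Finset.sum_add_distrib, Finset.sum_boole] at hsum
  have hc : (Finset.univ.filter fun i : Fin m => (i : ℕ) < m - k).card = m - k := by
    simp [Fin.card_filter_val_lt]
  rw [hc] at hsum
  simp only [Finset.sum_const, Finset.card_univ, Fintype.card_fin, nsmul_eq_mul] at hsum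
  -- As k ≤ n - 1, the total is at least m(n - 1) + (m - n + 1) = n(m - 1) + 1.
  have : (m : ℤ) - n + 1 ≤ ((m - k : ℕ) : ℤ) := by omega
  have hmn' : (n : ℤ) ≤ m := by exact_mod_cast hmn
  nlinarith

end Queen

/-! ### Classification of the divisors when α = n, and injectivity -/

section QueenStructure

variable {m n : ℕ}

/-- A divisor of positive rank and degree at most `n (m - 1)` all of whose nonempty legal sets
contain a full row has exactly one chip off an independent set of size `n`. -/
theorem exists_isIndepSet_of_no_small_legal (hn : 2 ≤ n) (hmn : n ≤ m)
    {D : Divisor (Fin m × Fin n)} (hD : Effective D) (hr : RankGE (queenGraph m n) D 1)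
    (hd : degree D ≤ (n : ℤ) * (m - 1))
    (hterm : ∀ U, NoFullRow U → Legal (queenGraph m n) D U → U = ∅) :
    ∃ Z : Finset (Fin m × Fin n), (queenGraph m n).IsIndepSet Z ∧ Z.card = n ∧
      D = oneOn ((Z : Set (Fin m × Fin n))ᶜ) := by
  have hm : 2 ≤ m := hn.trans hmn
  have hlegal : ∀ i j, D (i, j) = 0 → ∃ U, (i, j) ∉ U ∧ Legal (queenGraph m n) D U ∧
      ∀ l, ∃ k, (k, l) ∈ U := by
    intro i j hq
    obtain ⟨U, hne, hqU, hU⟩ := exists_legal_of_rankGE_one hr hq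
    refine ⟨U, hqU, hU, fun l => ?_⟩
    by_contra! hl
    have hs : ¬ NoFullRow U := fun hs => hne.ne_empty (hterm U hs hU)
    unfold NoFullRow at hs
    push Not at hs
    obtain ⟨r, hr⟩ := hs
    exact absurd hd (not_le.2 (hU.degree_gt hmn hD hr hl))
  have hzero : ∀ j, ∑ v ∈ row m j, D v < m → ∃ i, D (i, j) = 0 := by
    intro j hj
    by_contra! hne
    have h1 : ∑ _v ∈ row m j, (1 : ℤ) ≤ ∑ v ∈ row m j, D v := Finset.sum_le_sum fun v hv => by
      obtain ⟨i, l⟩ := v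
      obtain rfl : l = j := mem_row.1 hv
      have := hD (i, l)
      have := hne i
      omega
    rw [Finset.sum_const, card_row, nsmul_eq_mul, mul_one] at h1
    omega
  -- A row with fewer than m - 1 chips would have a chipless square, and the legal set avoiding that
  -- square would cut the row.
  have hge : ∀ j, 0 ≤ ∑ v ∈ row m j, D v - ((m : ℤ) - 1) := by
    intro j
    by_contra! hlt
    obtain ⟨i, hi⟩ := hzero j (by omega)
    obtain ⟨U, hqU, hU, hall⟩ := hlegal i j hi
    obtain ⟨k, hk⟩ := hall j
    have := hU.row_sum_ge hD hk hqU
    omega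
  have hexcess : ∑ j, (∑ v ∈ row m j, D v - ((m : ℤ) - 1)) = degree D - n * (m - 1) := by
    rw [Finset.sum_sub_distrib, ← degree_eq_sum_row]
    simp only [Finset.sum_const, Finset.card_univ, Fintype.card_fin, nsmul_eq_mul]
  have hrow : ∀ j, ∑ v ∈ row m j, D v = (m : ℤ) - 1 := fun j => by
    have := Finset.single_le_sum (fun j _ => hge j) (Finset.mem_univ j)
    have := hge j
    omega
  have hrow_le : ∀ j, ∑ v ∈ row m j, D v ≤ (m : ℤ) - 1 := fun j => (hrow j).le
  have hpos : ∀ {U}, Legal (queenGraph m n) D U → ∀ {p q}, p ∈ U → q ∉ U →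
      (queenGraph m n).Adj p q → 1 ≤ D p := by
    intro U hU p q hp hq hpq
    refine le_trans ?_ (hU p hp)
    have : q ∈ (queenGraph m n).neighborFinset p \ U := by simp [hpq, hq]
    exact_mod_cast Finset.card_pos.2 ⟨q, this⟩
  -- a legal set missing a chipless square contains the rest of the row
  have hfill : ∀ {i j U}, D (i, j) = 0 → (i, j) ∉ U → Legal (queenGraph m n) D U →
      (∀ l, ∃ k, (k, l) ∈ U) → ∀ k, k ≠ i → (k, j) ∈ U := by
    intro i j U hi hiU hU hall k hki
    by_contra hkU
    obtain ⟨a, ha⟩ := hall j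
    obtain ⟨htight, hcard⟩ := hU.row_tight hD (hrow_le j) ha hiU
    -- Two squares of the row are missing, so tightness leaves a single square (a, j) in `U`. Every
    -- square of a neighbouring row `l` then has a neighbour in row `j` off `U`. If row `l` lies in
    -- `U`, all its squares need chips, against its sum m - 1; if it is cut, (a, l) is in `U` by
    -- tightness of row `j` and violates tightness of row `l`.
    have hcard' : (row m j ∩ U).card = 1 := by
      refine hcard.resolve_right fun h1 => hki ?_
      have h2 := Finset.card_le_one.1 h1.le (k, j) (by simp [mem_row, hkU]) (i, j)
        (by simp [mem_row, hiU])
      exact (Prod.mk.inj h2).1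
    have huniq : ∀ b, b ≠ a → (b, j) ∉ U := by
      intro b hb hbU
      have h2 := Finset.card_le_one.1 hcard'.le (b, j) (by simp [mem_row, hbU]) (a, j)
        (by simp [mem_row, ha])
      exact hb (Prod.mk.inj h2).1
    obtain ⟨l, hl⟩ := exists_adjacent_row hn j
    have hlj : l ≠ j := by
      rintro rfl
      omega
    have hnbr : ∀ c : Fin m, ∃ b, b ≠ a ∧ (queenGraph m n).Adj (c, l) (b, j) := by
      intro c
      by_cases hca : c = a
      · obtain ⟨b, hb⟩ := exists_adjacent_col hm c
        refine ⟨b, fun h => ?_, queen_adj.2 (by omega)⟩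
        subst h
        subst hca
        omega
      · exact ⟨c, hca, queen_adj.2 (by omega)⟩
    by_cases hfull : ∀ c, (c, l) ∈ U
    · obtain ⟨c, hc⟩ := hzero l (by rw [hrow]; omega)
      obtain ⟨b, hb, hcb⟩ := hnbr c
      have := hpos hU (hfull c) (huniq b hb) hcb
      omega
    · push Not at hfull
      obtain ⟨c, hc⟩ := hfull
      have haU : (a, l) ∈ U := by
        by_contra haU
        exact hlj (htight a a l ha haU (queen_adj.2 (by omega)))
      obtain ⟨b, hb, hab⟩ := hnbr a
      exact hlj ((hU.row_tight hD (hrow_le l) haU hc).1 a b j haU (huniq b hb) hab).symm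
  have hone : ∀ i j, D (i, j) = 0 → ∀ k, k ≠ i → D (k, j) = 1 := by
    intro i j hi k hk
    obtain ⟨U, hqU, hU, hall⟩ := hlegal i j hi
    have hge1 : ∀ b, b ≠ i → 1 ≤ D (b, j) := fun b hb =>
      hpos hU (hfill hi hqU hU hall b hb) hqU ⟨by simpa using hb, Or.inr (Or.inl rfl)⟩
    have hsum := hrow j
    simp only [row_eq_map, Finset.sum_map, Function.Embedding.sectL_apply] at hsum
    have hle : ∀ b ∈ Finset.univ, (if b = i then (0 : ℤ) else 1) ≤ D (b, j) := fun b _ => by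
      split_ifs with hb
      · exact hD _
      · exact hge1 b hb
    have heq : ∑ b, (if b = i then (0 : ℤ) else 1) = ∑ b, D (b, j) := by
      have : ∀ b, (if b = i then (0 : ℤ) else 1) = 1 - if b = i then 1 else 0 := fun b => by
        split_ifs <;> rfl
      rw [hsum]
      simp [this, Finset.sum_sub_distrib]
    have := (Finset.sum_eq_sum_iff_of_le hle).1 heq k (Finset.mem_univ k)
    simpa [hk] using this.symm
  have hzero' : ∀ j, ∃ i, D (i, j) = 0 := fun j => hzero j (by rw [hrow]; omega)
  have hle1 : ∀ v, D v = if D v = 0 then 0 else 1 := by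
    rintro ⟨k, j⟩
    obtain ⟨i, hi⟩ := hzero' j
    by_cases hk : k = i
    · subst hk
      simp [hi]
    · simp [hone i j hi k hk]
  let Z : Finset (Fin m × Fin n) := Finset.univ.filter fun v => D v = 0
  have hDZ : D = oneOn ((Z : Set (Fin m × Fin n))ᶜ) := by
    funext v
    rw [oneOn_compl_apply, hle1 v]
    simp [Z]
  refine ⟨Z, ?_, ?_, hDZ⟩
  · rintro ⟨i, j⟩ hq ⟨i', j'⟩ hq' hne hadj
    have hi : D (i, j) = 0 := by simpa [Z] using hq
    have hi' : D (i', j') = 0 := by simpa [Z] using hq'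
    have hjj' : j ≠ j' := by
      rintro rfl
      have := hone i j hi i' fun h => hne (by rw [h])
      omega
    obtain ⟨U, hqU, hU, hall⟩ := hlegal i j hi
    have hqU' : (i', j') ∉ U := fun h => by
      have := hpos hU h hqU hadj.symm
      omega
    -- Every square of row `j` except (i, j) is in `U`, and its edges leaving `U` stay in row `j`.
    -- This rules out another chipless neighbour in a different column.
    have htight : ∀ {a l k}, (k, l) ∉ U → a ≠ i → (queenGraph m n).Adj (a, j) (k, l) → l = j := by
      intro a l k hkl ha had
      have haU := hfill hi hqU hU hall a ha
      exact (hU.row_tight hD (hrow_le j) haU hqU).1 a k l haU hkl had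
    have hne' : (j : ℕ) ≠ j' := fun h => hjj' (Fin.ext h)
    have hii' : i' = i := by
      by_contra hii
      exact hjj' (htight hqU' hii (queen_adj.2 (by omega))).symm
    subst hii'
    obtain ⟨l, hl⟩ := exists_adjacent_row hn j
    have hlj : l ≠ j := by
      rintro rfl
      omega
    -- Each square of row `l` has a neighbour in row `j` other than (i', j). So the row is fired
    -- completely, and its square in column i' would need two chips for the two chipless squares of
    -- that column.
    have hlU : ∀ c, (c, l) ∈ U := by
      intro c
      by_contra hc
      by_cases hci : c = i'
      · obtain ⟨b, hb⟩ := exists_adjacent_col hm c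
        refine hlj (htight hc (a := b) (fun h => ?_) (queen_adj.2 (by omega)))
        subst h
        subst hci
        omega
      · exact hlj (htight hc hci (queen_adj.2 (by omega)))
    have hlj' : (l : ℕ) ≠ j' := fun h => hqU' (Fin.ext h ▸ hlU i')
    have h2 : 2 ≤ ((queenGraph m n).neighborFinset (i', l) \ U).card := by
      have hsub : {(i', j), (i', j')} ⊆ (queenGraph m n).neighborFinset (i', l) \ U := by
        intro w hw
        rw [Finset.mem_insert, Finset.mem_singleton] at hw
        rw [Finset.mem_sdiff, SimpleGraph.mem_neighborFinset]
        rcases hw with rfl | rfl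
        · exact ⟨queen_adj.2 (by omega), hqU⟩
        · exact ⟨queen_adj.2 (by omega), hqU'⟩
      rw [← Finset.card_pair hne]
      exact Finset.card_le_card hsub
    have h3 := hU _ (hlU i')
    have h4 := hle1 (i', l)
    split_ifs at h4 <;> omega
  · have h1 : degree D = (n : ℤ) * (m - 1) := by
      have : ∑ j, (∑ v ∈ row m j, D v - ((m : ℤ) - 1)) = 0 :=
        Finset.sum_eq_zero fun j _ => by rw [hrow, sub_self]
      omega
    have h2 := degree_oneOn_compl Z
    rw [← hDZ, h1] at h2
    simp only [Fintype.card_prod, Fintype.card_fin, Nat.cast_mul] at h2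
    have : (Z.card : ℤ) = n := by linarith
    exact_mod_cast this

theorem card_le_of_isIndepSet {S : Finset (Fin m × Fin n)} (hS : (queenGraph m n).IsIndepSet S) :
    S.card ≤ n := by
  have h : Set.InjOn Prod.snd (S : Set (Fin m × Fin n)) := by
    intro v hv w hw h
    by_contra hne
    exact hS hv hw hne ⟨hne, Or.inr (Or.inl h)⟩
  simpa using Finset.card_le_card_of_injOn Prod.snd (fun _ _ => Finset.mem_univ _) h

theorem exists_isMaximumIndepSet_of_indepNum_eq (hn : 2 ≤ n) (hmn : n ≤ m)
    (hα : (queenGraph m n).indepNum = n) {D : Divisor (Fin m × Fin n)} (hD : Effective D)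
    (hr : RankGE (queenGraph m n) D 1)
    (hd : degree D ≤ (Fintype.card (Fin m × Fin n) : ℤ) - (queenGraph m n).indepNum) :
    ∃ S : Finset (Fin m × Fin n), (queenGraph m n).IsMaximumIndepSet S ∧
      Equivalent (queenGraph m n) D (oneOn ((S : Set (Fin m × Fin n))ᶜ)) := by
  have hd' : degree D ≤ (n : ℤ) * (m - 1) := by
    rw [hα] at hd
    simp only [Fintype.card_prod, Fintype.card_fin, Nat.cast_mul] at hd
    linarith
  have hm : 0 < m := by omega
  obtain ⟨D', h1, h2, h3⟩ := exists_no_small_legal (queenGraph m n) queen_preconnected NoFullRow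
    (fun j => ⟨⟨0, hm⟩, by simp⟩)
    (fun h => by
      obtain ⟨i, hi⟩ := h ⟨0, by omega⟩
      simp at hi) hD
    (fun D' h1 h2 U A hU hA hlU hlA => NoFullRow.union hn h2
      (by rwa [← degree_eq_of_equivalent _ h1]) hU hA hlU hlA)
  have hr' : RankGE (queenGraph m n) D' 1 := by
    have : Nonempty (Fin m × Fin n) := ⟨(⟨0, hm⟩, ⟨0, by omega⟩)⟩
    rw [← rank_pos_iff, ← rank_eq_of_equivalent _ h1, rank_pos_iff]
    exact hr
  rw [degree_eq_of_equivalent _ h1] at hd'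
  obtain ⟨Z, hZ, hZn, rfl⟩ := exists_isIndepSet_of_no_small_legal hn hmn h2 hr' hd' h3
  exact ⟨Z, ⟨hZ, fun T hT => (card_le_of_isIndepSet hT).trans_eq hZn.symm⟩, h1⟩

/-- In a set from which every square has at most one edge to the outside, no square can have two
outside neighbours. -/
theorem eq_of_card_sdiff_le_one {V : Type*} [Fintype V] [DecidableEq V] {G : SimpleGraph V}
    [DecidableRel G.Adj] {U : Finset V} {v p q : V}
    (h : (G.neighborFinset v \ U).card ≤ 1) (hp : G.Adj v p) (hq : G.Adj v q) (hpU : p ∉ U)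
    (hqU : q ∉ U) : p = q :=
  Finset.card_le_one.1 h p (by simp [hp, hpU]) q (by simp [hq, hqU])

theorem exists_fin_val_ne {N : ℕ} (hN : 3 ≤ N) (i k : Fin N) :
    ∃ a : Fin N, (a : ℕ) ≠ i ∧ (a : ℕ) ≠ k := by
  by_cases h0 : (i : ℕ) ≠ 0 ∧ (k : ℕ) ≠ 0
  · exact ⟨⟨0, by omega⟩, by simp only; omega⟩
  · by_cases h1 : (i : ℕ) ≠ 1 ∧ (k : ℕ) ≠ 1
    · exact ⟨⟨1, by omega⟩, by simp only; omega⟩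
    · exact ⟨⟨2, by omega⟩, by simp only; omega⟩

/-- Adjacent squares of `U` and `B` cannot have a common neighbour, as it would be a second outside
neighbour of one of them. Two squares in a common row or column do have one, so `U` and `B` share no
row or column. But then the two other corners of the rectangle spanned by u ∈ U and b ∈ B lie off
`B`, and both are adjacent to b. -/
theorem not_disjoint_of_card_sdiff_le_one (hn : 2 ≤ n) (hmn : n ≤ m)
    {U B : Finset (Fin m × Fin n)} (hUB : Disjoint U B) (hU0 : U.Nonempty) (hB0 : B.Nonempty)
    (hU : ∀ v ∈ U, ((queenGraph m n).neighborFinset v \ U).card ≤ 1)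
    (hB : ∀ v ∈ B, ((queenGraph m n).neighborFinset v \ B).card ≤ 1) : False := by
  have hcommon : ∀ u ∈ U, ∀ b ∈ B, (queenGraph m n).Adj u b →
      ∀ w, (queenGraph m n).Adj u w → ¬ (queenGraph m n).Adj b w := by
    intro u hu b hb hub w huw hbw
    have hbU : b ∉ U := Finset.disjoint_right.1 hUB hb
    have huB : u ∉ B := Finset.disjoint_left.1 hUB hu
    by_cases hwU : w ∈ U
    · have hwB : w ∉ B := Finset.disjoint_left.1 hUB hwU
      exact huw.ne (eq_of_card_sdiff_le_one (hB b hb) hub.symm hbw huB hwB)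
    · exact hbw.ne (eq_of_card_sdiff_le_one (hU u hu) hub huw hbU hwU)
  have hrow : ∀ i k j, (i, j) ∈ U → (k, j) ∉ B := by
    intro i k j hu hb
    have hik : (i : ℕ) ≠ k := fun h => Finset.disjoint_left.1 hUB hu (Fin.ext h ▸ hb)
    by_cases hm : 3 ≤ m
    · obtain ⟨a, ha, ha'⟩ := exists_fin_val_ne hm i k
      exact hcommon _ hu _ hb (queen_adj.2 (by omega)) (a, j)
        (queen_adj.2 (by omega)) (queen_adj.2 (by omega))
    · obtain ⟨l, hl⟩ := exists_adjacent_row hn j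
      exact hcommon _ hu _ hb (queen_adj.2 (by omega)) (i, l)
        (queen_adj.2 (by omega)) (queen_adj.2 (by omega))
  have hcol : ∀ i j l, (i, j) ∈ U → (i, l) ∉ B := by
    intro i j l hu hb
    have hjl : (j : ℕ) ≠ l := fun h => Finset.disjoint_left.1 hUB hu (Fin.ext h ▸ hb)
    by_cases hn' : 3 ≤ n
    · obtain ⟨a, ha, ha'⟩ := exists_fin_val_ne hn' j l
      exact hcommon _ hu _ hb (queen_adj.2 (by omega)) (i, a)
        (queen_adj.2 (by omega)) (queen_adj.2 (by omega))
    · obtain ⟨k, hk⟩ := exists_adjacent_col (hn.trans hmn) i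
      exact hcommon _ hu _ hb (queen_adj.2 (by omega)) (k, j)
        (queen_adj.2 (by omega)) (queen_adj.2 (by omega))
  obtain ⟨⟨i, j⟩, hu⟩ := hU0
  obtain ⟨⟨k, l⟩, hb⟩ := hB0
  have hik : (k : ℕ) ≠ i := fun h => hcol i j l hu (Fin.ext h ▸ hb)
  have hjl : (l : ℕ) ≠ j := fun h => hrow i k j hu (Fin.ext h ▸ hb)
  have h1 : (i, l) ∉ B := hcol i j l hu
  have h2 : (k, j) ∉ B := hrow i k j hu
  have := eq_of_card_sdiff_le_one (hB (k, l) hb) (p := (i, l)) (q := (k, j))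
    (queen_adj.2 (by omega)) (queen_adj.2 (by omega)) h1 h2
  exact hik (by rw [(Prod.mk.inj this).1])

/-- For a nonconstant script between the two divisors, its maximum set is legal for the first and
its minimum set for the second. With at most one chip per square, both sets have at most one
outgoing edge at each of their squares, which is impossible for disjoint sets. -/
theorem eq_of_equivalent_oneOn_compl (hn : 2 ≤ n) (hmn : n ≤ m) (S T : Finset (Fin m × Fin n))
    (h : Equivalent (queenGraph m n) (oneOn ((S : Set (Fin m × Fin n))ᶜ))
      (oneOn ((T : Set (Fin m × Fin n))ᶜ))) : S = T := by
  obtain ⟨g, hg⟩ := (equivalent_iff _).1 h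
  have heff : ∀ S : Finset (Fin m × Fin n), Effective (oneOn ((S : Set (Fin m × Fin n))ᶜ)) :=
    fun S v => by rw [oneOn_compl_apply]; split_ifs <;> simp
  have hle : ∀ (S : Finset (Fin m × Fin n)) {U},
      Legal (queenGraph m n) (oneOn ((S : Set (Fin m × Fin n))ᶜ)) U →
      ∀ v ∈ U, ((queenGraph m n).neighborFinset v \ U).card ≤ 1 := by
    intro S U hU v hv
    have := hU v hv
    rw [oneOn_compl_apply] at this
    split_ifs at this <;> omega
  have : Nonempty (Fin m × Fin n) := ⟨(⟨0, by omega⟩, ⟨0, by omega⟩)⟩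
  obtain ⟨x, hx⟩ := Finite.exists_max g
  obtain ⟨y, hy⟩ := Finite.exists_min g
  by_cases hxy : g x = g y
  · have hconst : ∀ v, g v = g y := fun v => le_antisymm ((hx v).trans_eq hxy) (hy v)
    have hl : laplacian (queenGraph m n) g = 0 := by
      funext v
      simp [laplacian, hconst]
    rw [hl, sub_zero] at hg
    ext v
    have hv := congrFun hg v
    rw [oneOn_compl_apply, oneOn_compl_apply] at hv
    split_ifs at hv <;> simp_all
  · exfalso
    have hU := legal_top (queenGraph m n) hg (heff T) hx
    have hB := legal_top (queenGraph m n) (D := oneOn ((T : Set (Fin m × Fin n))ᶜ))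
      (D' := oneOn ((S : Set (Fin m × Fin n))ᶜ)) (h := -g) (M := -g y)
      (by rw [laplacian_neg, hg]; abel) (heff S) (fun w => neg_le_neg (hy w))
    refine not_disjoint_of_card_sdiff_le_one hn hmn (Finset.disjoint_left.2 fun v hv hv' => ?_)
      ⟨x, by simp⟩ ⟨y, by simp⟩ (hle S hU) (hle T hB)
    simp only [Finset.mem_filter, Finset.mem_univ, true_and, Pi.neg_apply] at hv hv'
    omega

theorem queen_degree_pos (hn : 2 ≤ n) (v : Fin m × Fin n) : 0 < (queenGraph m n).degree v := by
  obtain ⟨i, j⟩ := v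
  obtain ⟨l, hl⟩ := exists_adjacent_row hn j
  rw [SimpleGraph.degree_pos_iff_exists_adj]
  exact ⟨(i, l), queen_adj.2 (by omega)⟩

end QueenStructure

/-! ### Graphs of large minimum degree -/

section MinDegree

variable {V : Type*} [Fintype V] [DecidableEq V] (G : SimpleGraph V) [DecidableRel G.Adj]

theorem sum_card_sdiff_compl (U : Finset V) :
    ∑ v ∈ Uᶜ, (G.neighborFinset v \ Uᶜ).card = ∑ v ∈ U, (G.neighborFinset v \ U).card := by
  have h : ∀ (A : Finset V) (v : V), (G.neighborFinset v \ A).card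
      = ∑ w ∈ Aᶜ, if G.Adj v w then 1 else 0 := by
    intro A v
    rw [← Finset.card_filter]
    congr 1
    ext w
    simp [and_comm]
  simp only [h, compl_compl]
  rw [Finset.sum_comm]
  simp only [G.adj_comm]

/-- A vertex of `U` has at most |U| - 1 of its neighbours inside `U`. -/
theorem mul_le_sum_card_sdiff {δ : ℕ} (hδ : ∀ v, δ ≤ G.degree v) (U : Finset V) :
    (U.card : ℤ) * (δ + 1 - U.card) ≤ ∑ v ∈ U, ((G.neighborFinset v \ U).card : ℤ) := by
  rw [← nsmul_eq_mul, ← Finset.sum_const]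
  refine Finset.sum_le_sum fun v hv => ?_
  have h1 := hδ v
  rw [← G.card_neighborFinset_eq_degree] at h1
  have h2 : G.neighborFinset v \ U.erase v = G.neighborFinset v \ U := by
    ext w
    simp only [Finset.mem_sdiff, SimpleGraph.mem_neighborFinset, Finset.mem_erase, not_and]
    exact ⟨fun h => ⟨h.1, h.2 h.1.ne'⟩, fun h => ⟨h.1, fun _ => h.2⟩⟩
  have h3 := Finset.le_card_sdiff (U.erase v) (G.neighborFinset v)
  rw [h2, Finset.card_erase_of_mem hv] at h3
  have := Finset.card_pos.2 ⟨v, hv⟩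
  omega

/-- In a graph of large minimum degree, effective divisors of positive rank and degree at most
`|V| - α` come from maximum independent sets. -/
theorem exists_isMaximumIndepSet_of_minDegree (hG : G.Preconnected) {δ : ℕ}
    (hδ : ∀ v, δ ≤ G.degree v) (hcard : 2 ≤ Fintype.card V) (hδV : Fintype.card V + 1 ≤ 2 * δ)
    {D : Divisor V} (hD : Effective D) (hr : RankGE G D 1)
    (hd : degree D ≤ (Fintype.card V : ℤ) - G.indepNum) (hdδ : degree D + 2 < 2 * δ) :
    ∃ S : Finset V, G.IsMaximumIndepSet S ∧ Equivalent G D (oneOn ((S : Set V)ᶜ)) := by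
  have hsmall : ∀ U : Finset V, 2 ≤ U.card → U.card + 1 ≤ δ →
      degree D < ∑ v ∈ U, ((G.neighborFinset v \ U).card : ℤ) := by
    intro U h1 h2
    refine lt_of_lt_of_le ?_ (mul_le_sum_card_sdiff G hδ U)
    have h3 : (2 : ℤ) ≤ U.card := by exact_mod_cast h1
    have h4 : (U.card : ℤ) + 1 ≤ δ := by exact_mod_cast h2
    -- For 2 ≤ s ≤ δ - 1, the product s(δ + 1 - s) exceeds 2(δ - 1) by (s - 2)(δ - 1 - s).
    nlinarith [mul_nonneg (sub_nonneg.2 h3) (sub_nonneg.2 h4)]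
  refine exists_isMaximumIndepSet_of_large_cuts G hG hcard hD hr hd (fun U h1 h2 => ?_)
    fun v w _ => ?_
  · have h3 := Finset.card_add_card_compl U
    by_cases h4 : U.card + 1 ≤ δ
    · exact hsmall U h1 h4
    -- The complement has at most |V| - δ ≤ δ - 1 vertices and the same cut edges.
    · have h5 := hsmall Uᶜ h2 (by omega)
      rwa [← Nat.cast_sum, sum_card_sdiff_compl, Nat.cast_sum] at h5
  · have := hδ v
    have := hδ w
    omega

end MinDegree

/-! ### Non-attacking queens and independence numbers -/

section Placement

/-- `f` places non-attacking queens in the columns `f j` of the rows `j < n`. -/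
def NonAttacking (n : ℕ) (f : ℕ → ℕ) : Prop :=
  ∀ i j, i < j → j < n → f i ≠ f j ∧ f i + j ≠ f j + i ∧ f i + i ≠ f j + j

/-- The main diagonal is kept free so that a queen in a new corner extends the placement to the next
odd board. Two staircases of slope 2 attack each other only along an antidiagonal, when 3(j - i) =
2k + 1; this needs k ≡ 1 mod 3, where another pattern is used. -/
theorem exists_nonAttacking_even {k : ℕ} (hk : 2 ≤ k) :
    ∃ f, NonAttacking (2 * k) f ∧ ∀ i < 2 * k, f i < 2 * k ∧ f i ≠ i := by
  by_cases h : k % 3 = 1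
  -- The first half is 2i + k - 1 reduced modulo 2k; the second half is its image under the
  -- half-turn of the board.
  · let f : ℕ → ℕ := fun i =>
      if i < k then (if 2 * i < k + 1 then 2 * i + k - 1 else 2 * i - k - 1)
      else (if 2 * (2 * k - 1 - i) < k + 1 then 2 * k - 1 - (2 * (2 * k - 1 - i) + k - 1)
        else 2 * k - 1 - (2 * (2 * k - 1 - i) - k - 1))
    refine ⟨f, fun i j hij hj => ?_, fun i hi => ?_⟩
    · simp only [f]
      split_ifs <;> omega
    · simp only [f]
      split_ifs <;> omega
  · let f : ℕ → ℕ := fun i => if i < k then 2 * i + 1 else 2 * (i - k)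
    refine ⟨f, fun i j hij hj => ?_, fun i hi => ?_⟩
    · simp only [f]
      split_ifs <;> omega
    · simp only [f]
      split_ifs <;> omega

theorem exists_nonAttacking_square {n : ℕ} (hn : 4 ≤ n) :
    ∃ f, NonAttacking n f ∧ ∀ i < n, f i < n := by
  obtain ⟨f, hf, hlt⟩ := exists_nonAttacking_even (k := n / 2) (by omega)
  rcases Nat.even_or_odd' n with ⟨k, rfl | rfl⟩
  · rw [Nat.mul_div_cancel_left k two_pos] at hf hlt
    exact ⟨f, hf, fun i hi => (hlt i hi).1⟩
  · rw [show (2 * k + 1) / 2 = k by omega] at hf hlt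
    refine ⟨fun i => if i < 2 * k then f i else 2 * k, fun i j hij hj => ?_, fun i hi => ?_⟩
    · have hi := hlt i (by omega)
      by_cases h : j < 2 * k
      · simp only [h, hij.trans h, if_true]
        exact hf i j hij h
      · simp only [h, show i < 2 * k by omega, if_true, if_false]
        omega
    · by_cases h : i < 2 * k
      · have := hlt i h
        simp only [h, if_true]
        omega
      · simp only [h, if_false]
        omega

theorem exists_nonAttacking {m n : ℕ} (hn : 2 ≤ n) (hmn : n ≤ m) (h2 : ¬(m = 2 ∧ n = 2))
    (h3 : ¬(m = 3 ∧ n = 3)) : ∃ f, NonAttacking n f ∧ ∀ i < n, f i < m := by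
  by_cases h4 : 4 ≤ n
  · obtain ⟨f, hf, hlt⟩ := exists_nonAttacking_square h4
    exact ⟨f, hf, fun i hi => (hlt i hi).trans_le hmn⟩
  · by_cases hn2 : n = 2
    · subst hn2
      refine ⟨fun i => 2 * i, fun i j hij hj => ?_, fun i hi => ?_⟩ <;> simp only <;> omega
    · obtain rfl : n = 3 := by omega
      -- Columns 1, 3, 0, which fit because m ≥ 4.
      refine ⟨fun i => if i = 2 then 0 else 2 * i + 1, fun i j hij hj => ?_, fun i hi => ?_⟩
      · simp only
        split_ifs <;> omega
      · simp only
        split_ifs <;> omega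

theorem indepNum_eq {m n : ℕ} (hn : 2 ≤ n) (hmn : n ≤ m) (h2 : ¬(m = 2 ∧ n = 2))
    (h3 : ¬(m = 3 ∧ n = 3)) : (queenGraph m n).indepNum = n := by
  refine le_antisymm ?_ ?_
  · obtain ⟨S, hS, hc⟩ := (queenGraph m n).exists_isNIndepSet_indepNum
    rw [← hc]
    exact card_le_of_isIndepSet hS
  · obtain ⟨f, hf, hlt⟩ := exists_nonAttacking hn hmn h2 h3
    let e : Fin n ↪ Fin m × Fin n :=
      ⟨fun j => (⟨f j, hlt j j.2⟩, j), fun a b h => (Prod.mk.inj h).2⟩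
    have hS : (queenGraph m n).IsIndepSet (Finset.univ.map e : Finset (Fin m × Fin n)) := by
      intro v hv w hw hne hadj
      simp only [Finset.coe_map, Finset.coe_univ, Set.image_univ, Set.mem_range] at hv hw
      obtain ⟨i, rfl⟩ := hv
      obtain ⟨j, rfl⟩ := hw
      have h := queen_adj.1 hadj
      simp only at h
      rcases lt_trichotomy (i : ℕ) j with hij | hij | hij
      · have := hf i j hij j.2
        omega
      · exact hne (by rw [Fin.ext hij])
      · have := hf j i hij i.2
        omega
    simpa using hS.card_le_indepNum

theorem indepNum_two : (queenGraph 2 2).indepNum = 1 := by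
  have hadj : ∀ v w, v ≠ w → (queenGraph 2 2).Adj v w := by decide
  refine le_antisymm ?_ ?_
  · obtain ⟨S, hS, hc⟩ := (queenGraph 2 2).exists_isNIndepSet_indepNum
    rw [← hc, Finset.card_le_one]
    intro v hv w hw
    by_contra hne
    exact hS hv hw hne (hadj v w hne)
  · have hS : (queenGraph 2 2).IsIndepSet (({(0, 0)} : Finset (Fin 2 × Fin 2)) : Set _) := by
      simp [SimpleGraph.isIndepSet_iff]
    simpa using hS.card_le_indepNum

theorem indepNum_three : (queenGraph 3 3).indepNum = 2 := by
  -- Three independent squares would occupy one square in each row, and any such triple contains an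
  -- attacking pair.
  have hadj : ∀ a b c, (queenGraph 3 3).Adj (a, 0) (b, 1) ∨ (queenGraph 3 3).Adj (a, 0) (c, 2) ∨
      (queenGraph 3 3).Adj (b, 1) (c, 2) := by decide
  refine le_antisymm ?_ ?_
  · obtain ⟨S, hS, hc⟩ := (queenGraph 3 3).exists_isNIndepSet_indepNum
    rw [← hc]
    by_contra! h3
    have hinj : Set.InjOn Prod.snd (S : Set (Fin 3 × Fin 3)) := by
      intro v hv w hw h
      by_contra hne
      exact hS hv hw hne ⟨hne, Or.inr (Or.inl h)⟩
    have himg : S.image Prod.snd = Finset.univ := by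
      rw [← Finset.card_eq_iff_eq_univ, Finset.card_image_of_injOn hinj, Fintype.card_fin]
      exact le_antisymm (card_le_of_isIndepSet hS) h3
    have hrow : ∀ j : Fin 3, ∃ i, (i, j) ∈ S := by
      intro j
      obtain ⟨⟨i, l⟩, h, rfl⟩ := Finset.mem_image.1 (himg ▸ Finset.mem_univ j)
      exact ⟨i, h⟩
    obtain ⟨a, ha⟩ := hrow 0
    obtain ⟨b, hb⟩ := hrow 1
    obtain ⟨c, hc⟩ := hrow 2
    rcases hadj a b c with h | h | h
    · exact hS ha hb h.ne h
    · exact hS ha hc h.ne h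
    · exact hS hb hc h.ne h
  · have hne : ((0, 0) : Fin 3 × Fin 3) ≠ (1, 2) := by decide
    have hnadj : ¬ (queenGraph 3 3).Adj (0, 0) (1, 2) := by decide
    have hS : (queenGraph 3 3).IsIndepSet
        (({(0, 0), (1, 2)} : Finset (Fin 3 × Fin 3)) : Set (Fin 3 × Fin 3)) := by
      rw [Finset.coe_pair]
      exact Set.pairwise_pair.2 fun _ => ⟨hnadj, fun h => hnadj h.symm⟩
    have := hS.card_le_indepNum
    rwa [Finset.card_pair hne] at this

end Placement

end ChipFiring

theorem theorem1 (m n : ℕ) (hn : 2 ≤ n) (hmn : n ≤ m) :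
    ChipFiring.gonality (ChipFiring.queenGraph m n)
        = (m : ℤ) * (n : ℤ) - ((ChipFiring.queenGraph m n).indepNum : ℤ) ∧
    ChipFiring.gonality (ChipFiring.queenGraph m n)
        = (if m = 2 ∧ n = 2 then 3 else if m = 3 ∧ n = 3 then 7
            else (n : ℤ) * ((m : ℤ) - 1)) ∧
    Set.BijOn
      (fun S : Finset (Fin m × Fin n) =>
        ChipFiring.divisorClass (ChipFiring.queenGraph m n)
          (ChipFiring.oneOn ((S : Set (Fin m × Fin n))ᶜ)))
      {S | (ChipFiring.queenGraph m n).IsMaximumIndepSet S}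
      {c | ChipFiring.classRank (ChipFiring.queenGraph m n) c = 1 ∧
        ChipFiring.classDegree (ChipFiring.queenGraph m n) c
          = ChipFiring.gonality (ChipFiring.queenGraph m n)} := by
  have : Nonempty (Fin m × Fin n) := ⟨(⟨0, by omega⟩, ⟨0, by omega⟩)⟩
  obtain ⟨hgon, hbij⟩ := ChipFiring.gonality_eq_and_bijOn (ChipFiring.queenGraph m n)
    (ChipFiring.queen_degree_pos hn) (ChipFiring.eq_of_equivalent_oneOn_compl hn hmn) (by
      intro D hD hr hd
      by_cases h2 : m = 2 ∧ n = 2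
      · obtain ⟨rfl, rfl⟩ := h2
        refine ChipFiring.exists_isMaximumIndepSet_of_minDegree _ ChipFiring.queen_preconnected
          (δ := 3) (by decide) (by simp) (by simp) hD hr hd ?_
        rw [ChipFiring.indepNum_two] at hd
        simp at hd ⊢
        omega
      · by_cases h3 : m = 3 ∧ n = 3
        · obtain ⟨rfl, rfl⟩ := h3
          refine ChipFiring.exists_isMaximumIndepSet_of_minDegree _ ChipFiring.queen_preconnected
            (δ := 6) (by decide) (by simp) (by simp) hD hr hd ?_
          rw [ChipFiring.indepNum_three] at hd
          simp at hd ⊢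
          omega
        · exact ChipFiring.exists_isMaximumIndepSet_of_indepNum_eq hn hmn
            (ChipFiring.indepNum_eq hn hmn h2 h3) hD hr hd)
  have hcard : (Fintype.card (Fin m × Fin n) : ℤ) = (m : ℤ) * n := by simp
  rw [hcard] at hgon
  refine ⟨hgon, ?_, hbij⟩
  rw [hgon]
  split_ifs with h2 h3
  · obtain ⟨rfl, rfl⟩ := h2
    rw [ChipFiring.indepNum_two]
    norm_num
  · obtain ⟨rfl, rfl⟩ := h3
    rw [ChipFiring.indepNum_three]
    norm_num
  · rw [ChipFiring.indepNum_eq hn hmn h2 h3]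
    ring
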